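/- Let $M$ be a smooth manifold of dimension $n\ge 2$, $T_0M$ its tangent bundle with the zero section removed, $\mathcal C=y^i\frac{\partial}{\partial y^i}$ the Liouville vector field and $J=dx^i\otimes\frac{\partial}{\partial y^i}$ the tangent endomorphism. A spray is a vector field $S\in\mathfrak X(T_0M)$ with $JS=\mathcal C$ and $[\mathcal C,S]=S$. For a spray $S$ put $$h=\tfrac12(\mathrm{Id}-[S,J]),\quad v=\tfrac12(\mathrm{Id}+[S,J]),\quad \Phi=v\circ[S,h]=R^i_j\,\frac{\partial}{\partial y^i}\otimes dx^j,\quad \operatorname{Tr}\Phi=R^i_i,\quad R=\tfrac12[h,h],$$ where the brackets are Frölicher–Nijenhuis brackets, and define the Weyl-type curvature tensor $$W_1=R-\frac{1}{2(n-1)}\,d_J(\operatorname{Tr}\Phi)\wedge J .$$ Here $d_Kf=df\circ K$ for a function $f$ and a vector valued $1$-form $K$, $d_K\omega=i_Kd\omega-d(i_K\omega)$ for a $1$-form $\omega$, and $(\omega\wedge K)(X,Y)=\omega(X)KY-\omega(Y)KX$. For a function $L$ on $T_0M$ let $\delta_SL=\mathcal L_Sd_JL-dL$ be its Euler–Lagrange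 $1$-form. Let $S$ be a spray, let $P\in C^\infty(T_0M)$ be $1$-homogeneous, i.e. $\mathcal C(P)=P$, and let $\overline S=S-2P\mathcal C$ be the corresponding projectively related spray. Then the tensors $\overline{W_1}$ of $\overline S$ and $W_1$ of $S$ satisfy, on $T_0M$, $$\overline{W_1}=W_1+\tfrac12\,\delta_SP\wedge J+d_Jd_hP\otimes\mathcal C .$$ Moreover, $\overline{W_1}=W_1$ if and only if $P$ is a Hamel function for $S$, i.e. a $1$-homogeneous function with $\delta_SP=0$. -/

import Mathlib

open Filter Topology
open scoped Manifold ContDiff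

noncomputable section

namespace SprayGeometry

variable {E : Type*} [NormedAddCommGroup E] [NormedSpace ℝ E]
  {M : Type*} [TopologicalSpace M] [ChartedSpace E M] [IsManifold 𝓘(ℝ, E) ∞ M]

/-- The tangent bundle `TM` of a manifold `M` modelled on `E`, a manifold modelled on `E × E`. -/
abbrev TM (E : Type*) [NormedAddCommGroup E] [NormedSpace ℝ E]
    (M : Type*) [TopologicalSpace M] [ChartedSpace E M] [IsManifold 𝓘(ℝ, E) ∞ M] : Type _ :=
  TangentBundle 𝓘(ℝ, E) M

/-- The slit tangent bundle `T₀M`: the tangent bundle with the zero section removed. -/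
def slit (E : Type*) [NormedAddCommGroup E] [NormedSpace ℝ E]
    (M : Type*) [TopologicalSpace M] [ChartedSpace E M] [IsManifold 𝓘(ℝ, E) ∞ M] :
    Set (TM E M) :=
  {p | p.2 ≠ 0}

/-- (Not necessarily smooth) vector fields on the manifold `TM`. Only their values on open subsets
of `T₀M` matter below. -/
abbrev VF (E : Type*) [NormedAddCommGroup E] [NormedSpace ℝ E]
    (M : Type*) [TopologicalSpace M] [ChartedSpace E M] [IsManifold 𝓘(ℝ, E) ∞ M] : Type _ :=
  (p : TM E M) → TangentSpace 𝓘(ℝ, E).tangent p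

/-- The vector field `X` is smooth at each point of the set `U`. -/
def SmoothVFOn (U : Set (TM E M)) (X : VF E M) : Prop :=
  ∀ p ∈ U, ContMDiffAt 𝓘(ℝ, E).tangent 𝓘(ℝ, E).tangent.tangent ∞
    (fun q => (⟨q, X q⟩ : TangentBundle 𝓘(ℝ, E).tangent (TM E M))) p

/-- The vector field `X` is defined and smooth on some open neighbourhood of `p`. Tensor fields on
`T₀M` are tested, at a point `p`, on such local vector fields. -/
def SmoothNear (p : TM E M) (X : VF E M) : Prop :=
  ∃ U : Set (TM E M), IsOpen U ∧ p ∈ U ∧ SmoothVFOn U X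

/-- The Lie bracket of vector fields on `TM`. -/
def bracket (X Y : VF E M) : VF E M :=
  VectorField.mlieBracket 𝓘(ℝ, E).tangent X Y

/-- The derivative `X f` of a function along a vector field. -/
def deriv (X : VF E M) (f : TM E M → ℝ) : TM E M → ℝ :=
  fun p => mfderiv 𝓘(ℝ, E).tangent 𝓘(ℝ, ℝ) f p (X p)

/-! ### The canonical structures of the tangent bundle -/

/-- The differential at `p = (x, y)` of the projection `π : TM → M`. -/
def dproj (p : TM E M) :
    TangentSpace 𝓘(ℝ, E).tangent p →L[ℝ] TangentSpace 𝓘(ℝ, E) p.1 :=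
  mfderiv 𝓘(ℝ, E).tangent 𝓘(ℝ, E) (fun q : TM E M => q.1) p

/-- The vertical lift at `p = (x, y)`: the differential at `y` of the inclusion of the fibre
`T_x M` (which is a copy of the vector space `E`) into `TM`. In induced coordinates it sends
`w^i ∂/∂x^i` to `w^i ∂/∂y^i`. -/
def vlift (p : TM E M) :
    TangentSpace 𝓘(ℝ, E) p.1 →L[ℝ] TangentSpace 𝓘(ℝ, E).tangent p :=
  mfderiv 𝓘(ℝ, E) 𝓘(ℝ, E).tangent
    (fun w : E => (⟨p.1, (w : TangentSpace 𝓘(ℝ, E) p.1)⟩ : TM E M)) (p.2 : E)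

/-- The Liouville vector field `C = y^i ∂/∂y^i`. -/
def liouville : VF E M := fun p => vlift p p.2

/-- The tangent endomorphism `J = dx^i ⊗ ∂/∂y^i`, acting on vector fields. -/
def J (X : VF E M) : VF E M := fun p => vlift p (dproj p (X p))

/-! ### Frölicher–Nijenhuis calculus

Vector valued forms are represented by their action on vector fields. -/

/-- The Frölicher–Nijenhuis bracket `[S, K]` of a vector field `S` and a vector valued `1`-form
`K`, that is, the Lie derivative of `K` along `S`: `[S, K] X = [S, K X] - K [S, X]`. -/
def bracketVFEnd (S : VF E M) (K : VF E M → VF E M) (X : VF E M) : VF E M :=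
  bracket S (K X) - K (bracket S X)

/-- The Frölicher–Nijenhuis bracket `[K, L]` of two vector valued `1`-forms. -/
def bracketEndEnd (K L : VF E M → VF E M) (X Y : VF E M) : VF E M :=
  bracket (K X) (L Y) + bracket (L X) (K Y) + K (L (bracket X Y)) + L (K (bracket X Y))
    - K (bracket (L X) Y) - K (bracket X (L Y)) - L (bracket (K X) Y) - L (bracket X (K Y))

/-- The `1`-form `d_K f = df ∘ K`, for a function `f` and a vector valued `1`-form `K`. -/
def dEnd (K : VF E M → VF E M) (f : TM E M → ℝ) (X : VF E M) : TM E M → ℝ :=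
  deriv (K X) f

/-- The `2`-form `d_K α = i_K dα - d (i_K α)`, for a `1`-form `α` and a vector valued `1`-form `K`,
where `i_K α = α ∘ K` and `(i_K θ)(X, Y) = θ(K X, Y) + θ(X, K Y)` for a `2`-form `θ`. Expanding the
exterior derivatives, the terms `X (α(K Y))` and `Y (α(K X))` cancel. -/
def dEndForm (K : VF E M → VF E M) (α : VF E M → TM E M → ℝ) (X Y : VF E M) : TM E M → ℝ :=
  deriv (K X) (α Y) - deriv (K Y) (α X) - α (bracket (K X) Y) - α (bracket X (K Y))
    + α (K (bracket X Y))

/-- The wedge product `α ∧ K` of a `1`-form and a vector valued `1`-form: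
`(α ∧ K)(X, Y) = α(X) K Y - α(Y) K X`. -/
def wedge (α : VF E M → TM E M → ℝ) (K : VF E M → VF E M) (X Y : VF E M) : VF E M :=
  fun p => α X p • K Y p - α Y p • K X p

/-- The tensor product `θ ⊗ Z` of a `2`-form and a vector field: `(θ ⊗ Z)(X, Y) = θ(X, Y) Z`. -/
def tensor (θ : VF E M → VF E M → TM E M → ℝ) (Z : VF E M) (X Y : VF E M) : VF E M :=
  fun p => θ X Y p • Z p

/-- The Lie derivative `L_S α` of a `1`-form: `(L_S α)(X) = S (α(X)) - α([S, X])`. -/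
def lieForm (S : VF E M) (α : VF E M → TM E M → ℝ) (X : VF E M) : TM E M → ℝ :=
  deriv S (α X) - α (bracket S X)

/-! ### Sprays and their geometric structures -/

/-- A spray: a smooth vector field `S` on `T₀M` with `J S = C` and `[C, S] = S`. -/
structure IsSpray (S : VF E M) : Prop where
  smooth : SmoothVFOn (slit E M) S
  semispray : ∀ p ∈ slit E M, J S p = liouville p
  homogeneous : ∀ p ∈ slit E M, bracket liouville S p = S p

/-- A function `P ∈ C^∞(T₀M)` that is `1`-homogeneous, i.e. `C(P) = P`. -/
structure IsHomogeneous (P : TM E M → ℝ) : Prop where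
  smooth : ∀ p ∈ slit E M, ContMDiffAt 𝓘(ℝ, E).tangent 𝓘(ℝ, ℝ) ∞ P p
  euler : ∀ p ∈ slit E M, deriv liouville P p = P p

/-- The projective deformation `S - 2 P C` of `S` with projective factor `P`. -/
def deform (S : VF E M) (P : TM E M → ℝ) : VF E M :=
  fun p => S p - (2 * P p) • liouville p

/-- The horizontal projector `h = (Id - [S, J]) / 2`. -/
def hor (S : VF E M) (X : VF E M) : VF E M :=
  (1 / 2 : ℝ) • (X - bracketVFEnd S J X)

/-- The vertical projector `v = (Id + [S, J]) / 2`. -/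
def ver (S : VF E M) (X : VF E M) : VF E M :=
  (1 / 2 : ℝ) • (X + bracketVFEnd S J X)

/-- The Jacobi endomorphism `Φ = v ∘ [S, h]`. -/
def jacobi (S : VF E M) (X : VF E M) : VF E M :=
  ver S (bracketVFEnd S (hor S) X)

/-- The curvature tensor `R = [h, h] / 2` of the nonlinear connection. -/
def curvature (S : VF E M) (X Y : VF E M) : VF E M :=
  (1 / 2 : ℝ) • bracketEndEnd (hor S) (hor S) X Y

/-- The linear endomorphism `A` of `T_x M` represents, at `p = (x, y)`, the semi-basic vector valued
`1`-form `K`. If `K = K^i_j ∂/∂y^i ⊗ dx^j` in induced coordinates, then `A` has the matrix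
`K^i_j(p)`. -/
def Represents (K : VF E M → VF E M) (p : TM E M)
    (A : TangentSpace 𝓘(ℝ, E) p.1 →ₗ[ℝ] TangentSpace 𝓘(ℝ, E) p.1) : Prop :=
  ∀ X : VF E M, SmoothNear p X → K X p = vlift p (A (dproj p (X p)))

open Classical in
/-- The trace `K^i_i` of a semi-basic vector valued `1`-form `K = K^i_j ∂/∂y^i ⊗ dx^j`: at each
point `p = (x, y)`, the trace of the endomorphism of `T_x M` that represents `K`. -/
def trace (K : VF E M → VF E M) (p : TM E M) : ℝ :=
  if H : ∃ A, Represents K p A then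
    LinearMap.trace ℝ (TangentSpace 𝓘(ℝ, E) p.1) H.choose
  else 0

/-- The Weyl-type curvature tensor `W₁ = R - (1 / (2 (n - 1))) d_J(Tr Φ) ∧ J`, `n = dim M`. -/
def weyl (S : VF E M) (X Y : VF E M) : VF E M :=
  curvature S X Y -
    (1 / (2 * ((Module.finrank ℝ E : ℝ) - 1))) • wedge (dEnd J (trace (jacobi S))) J X Y

/-- The Euler–Lagrange `1`-form `δ_S L = L_S d_J L - dL`. -/
def eulerLagrange (S : VF E M) (L : TM E M → ℝ) (X : VF E M) : TM E M → ℝ :=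
  lieForm S (dEnd J L) X - deriv X L

/-- A Hamel function for `S`: a `1`-homogeneous smooth function `P` on `T₀M` with `δ_S P = 0`. -/
def IsHamel (S : VF E M) (P : TM E M → ℝ) : Prop :=
  IsHomogeneous P ∧
    ∀ p ∈ slit E M, ∀ X : VF E M, SmoothNear p X → eulerLagrange S P X p = 0

end SprayGeometry

end

/-! The proof is a computation in induced coordinates `(x, y)`. There S = y^i ∂/∂x^i − 2G^i ∂/∂y^i,
and passing to S − 2PC replaces G by G + P y. All the tensors involved are semi-basic: at a point
they depend only on the horizontal components `a`, `b` of the test fields, so each becomes an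
expression in the derivatives of G and P. With N = ∂G/∂y, the horizontal lift of `a` is `(a, -N a)`,
R is the antisymmetrised horizontal derivative of N, and Φ is 2 ∂G/∂x − S(N) − N²
(`LocalSpray.coord_hor`, `LocalSpray.coord_curvature`, `LocalSpray.coord_jacobi`).

The conditions [C, S] = S and C(P) = P are Euler's relations ∂G/∂y · y = 2G and ∂P/∂y · y = P. They
yield Φ̄ = Φ + (P² − S(P)) J + α ⊗ C for a semi-basic α whose value on y is −(P² − S(P)), hence Tr
Φ̄ = Tr Φ + (n − 1)(P² − S(P)) (`HomogeneousPair.trace_jacobiCoeff`). The factor n − 1 cancels the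
normalisation of W₁. Adding the change of R, the terms in P · d_J P cancel and what remains is ½ δ_S
P ∧ J + d_J d_h P ⊗ C (`HomogeneousPair.weyl_deformCoeff`).

For the equivalence, insert S as second argument. Since δ_S P(S) = 0 and d_J d_h P(X, S) = δ_S P(X),
the difference of the two tensors on (X, S) is (3/2) δ_S P(X) C, and C has no zero on T₀M; so
equality forces δ_S P = 0. Conversely, if δ_S P vanishes on an open set, so do its vertical
derivatives, and antisymmetrising them gives d_J d_h P = 0 (`HomogeneousPair.dJdhCoeff_eq_zero`). -/

noncomputable section

namespace SprayGeometry

/-! ### Induced charts of the tangent bundle. -/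

section
variable {E : Type*} [NormedAddCommGroup E] [NormedSpace ℝ E]
  {M : Type*} [TopologicalSpace M] [ChartedSpace E M] [IsManifold 𝓘(ℝ, E) ∞ M]

/-- The induced chart of `TM` around `p₀`, with values in `E × E`. -/
def chart (p₀ : TM E M) : PartialEquiv (TM E M) (E × E) := extChartAt 𝓘(ℝ, E).tangent p₀

/-- The vector field `X` read in the induced chart around `p₀`. -/
def coord (p₀ : TM E M) (X : VF E M) : E × E → E × E :=
  VectorField.mpullback 𝓘(ℝ, E × E) 𝓘(ℝ, E).tangent (chart p₀).symm X

variable {p₀ : TM E M} {z : E × E} {X Y : VF E M}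

lemma isOpen_chart_target : IsOpen (chart p₀).target := isOpen_extChartAt_target p₀

lemma isOpen_chart_source : IsOpen (chart p₀).source := isOpen_extChartAt_source p₀

lemma contMDiffAt_chart_symm (hz : z ∈ (chart p₀).target) :
    ContMDiffAt 𝓘(ℝ, E × E) 𝓘(ℝ, E).tangent ∞ (chart p₀).symm z :=
  (contMDiffOn_extChartAt_symm p₀).contMDiffAt (isOpen_chart_target.mem_nhds hz)

lemma contMDiffAt_chart {q : TM E M} (hq : q ∈ (chart p₀).source) :
    ContMDiffAt 𝓘(ℝ, E).tangent 𝓘(ℝ, E × E) ∞ (chart p₀) q :=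
  contMDiffOn_extChartAt.contMDiffAt (by
    have := isOpen_chart_source.mem_nhds hq
    rwa [chart, extChartAt_source] at this)

/-- The differential of the parametrization of `TM` given by the induced chart around `p₀`. -/
def dparam (p₀ : TM E M) (z : E × E) :
    E × E →L[ℝ] TangentSpace 𝓘(ℝ, E).tangent ((chart p₀).symm z) :=
  mfderiv 𝓘(ℝ, E × E) 𝓘(ℝ, E).tangent (chart p₀).symm z

lemma isInvertible_dparam (hz : z ∈ (chart p₀).target) :
    (dparam p₀ z).IsInvertible := by
  have := isInvertible_mfderivWithin_extChartAt_symm (I := 𝓘(ℝ, E).tangent) hz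
  rw [ModelWithCorners.range_eq_univ, mfderivWithin_univ] at this
  exact this

lemma coord_apply : coord p₀ X z = (dparam p₀ z).inverse (X ((chart p₀).symm z)) := rfl

lemma dparam_coord (hz : z ∈ (chart p₀).target) :
    dparam p₀ z (coord p₀ X z) = X ((chart p₀).symm z) := by
  rw [coord_apply]
  obtain ⟨e, he⟩ := isInvertible_dparam hz
  rw [← he]; simp

lemma coord_eq_of_dparam {u : E × E} (hz : z ∈ (chart p₀).target)
    (h : X ((chart p₀).symm z) = dparam p₀ z u) : coord p₀ X z = u := by
  rw [coord_apply, h]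
  obtain ⟨e, he⟩ := isInvertible_dparam hz
  rw [← he]; simp

lemma eq_iff_coord_eq (hz : z ∈ (chart p₀).target) :
    X ((chart p₀).symm z) = Y ((chart p₀).symm z) ↔ coord p₀ X z = coord p₀ Y z := by
  refine ⟨fun h => by rw [coord_apply, coord_apply, h], fun h => ?_⟩
  rw [← dparam_coord (X := X) hz, ← dparam_coord (X := Y) hz, h]

lemma coord_add : coord p₀ (X + Y) z = coord p₀ X z + coord p₀ Y z :=
  VectorField.mpullback_add_apply

lemma coord_neg : coord p₀ (-X) z = -coord p₀ X z :=
  VectorField.mpullback_neg_apply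

lemma coord_sub : coord p₀ (X - Y) z = coord p₀ X z - coord p₀ Y z := by
  rw [sub_eq_add_neg, coord_add, coord_neg, sub_eq_add_neg]

lemma coord_smul (c : ℝ) : coord p₀ (c • X) z = c • coord p₀ X z :=
  VectorField.mpullback_const_smul_apply

/-! ### The canonical structures in induced coordinates -/

/-- The differential of the chart of `M` around `p₀.1`, inverted, along the induced chart. -/
def dbase (p₀ : TM E M) (z : E × E) :
    E →L[ℝ] TangentSpace 𝓘(ℝ, E) ((chart p₀).symm z).1 :=
  mfderiv 𝓘(ℝ, E) 𝓘(ℝ, E) (extChartAt 𝓘(ℝ, E) p₀.1).symm z.1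

/-- An induced chart contains whole fibres, so its image is constrained only in the base variable.
-/
lemma mem_chart_target : z ∈ (chart p₀).target ↔ z.1 ∈ (extChartAt 𝓘(ℝ, E) p₀.1).target := by
  rw [chart, FiberBundle.extChartAt_target]
  simp only [Set.mem_prod, Set.mem_inter_iff, Set.mem_preimage, Set.mem_univ, and_true,
    TangentBundle.trivializationAt_baseSet, and_iff_left_iff_imp]
  intro h
  have := (extChartAt 𝓘(ℝ, E) p₀.1).map_target h
  rwa [extChartAt_source] at this

lemma isInvertible_dbase (hz : z ∈ (chart p₀).target) : (dbase p₀ z).IsInvertible := by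
  have := isInvertible_mfderivWithin_extChartAt_symm (I := 𝓘(ℝ, E)) (mem_chart_target.1 hz)
  rw [ModelWithCorners.range_eq_univ, mfderivWithin_univ] at this
  exact this

/-- The trivialization of the tangent bundle that defines the induced chart is inverse, on fibres,
to the differential of the parametrization of the base. -/
lemma chart_symm_apply (hz : z ∈ (chart p₀).target) :
    (chart p₀).symm z = ⟨((chart p₀).symm z).1, dbase p₀ z z.2⟩ := by
  have hx := (extChartAt 𝓘(ℝ, E) p₀.1).map_target (mem_chart_target.1 hz)
  rw [extChartAt_source] at hx
  have h := TangentBundle.symmL_trivializationAt (I := 𝓘(ℝ, E)) hx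
  rw [ModelWithCorners.range_eq_univ, mfderivWithin_univ,
    (extChartAt 𝓘(ℝ, E) p₀.1).right_inv (mem_chart_target.1 hz)] at h
  have h' : dbase p₀ z z.2 = (trivializationAt E (TangentSpace 𝓘(ℝ, E)) p₀.1).symm
      ((extChartAt 𝓘(ℝ, E) p₀.1).symm z.1) z.2 := by
    exact (congrArg (fun L : E →L[ℝ] E => L z.2) h).symm.trans
      (Bundle.Trivialization.symmL_apply _ hx _)
  rw [h']
  refine Eq.trans ?_ ((trivializationAt E (TangentSpace 𝓘(ℝ, E)) p₀.1).mk_symm hx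
    z.2).symm
  rw [chart, FiberBundle.extChartAt]
  rfl

lemma snd_chart_symm (hz : z ∈ (chart p₀).target) :
    ((chart p₀).symm z).2 = dbase p₀ z z.2 := by
  -- Stated for a variable point because the type of the fibre component depends on the base point.
  have key : ∀ (q : TM E M) (v : TangentSpace 𝓘(ℝ, E) q.1), q = ⟨q.1, v⟩ → q.2 = v := by
    rintro ⟨x, w⟩ v h
    simpa using h
  exact key _ _ (chart_symm_apply hz)

/-- Chain rule: in an induced chart the projection π is the first projection of `E × E`. -/
lemma dproj_dparam (hz : z ∈ (chart p₀).target) (u : E × E) :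
    dproj ((chart p₀).symm z) (dparam p₀ z u) = dbase p₀ z u.1 := by
  have hφ := (contMDiffAt_chart_symm hz).mdifferentiableAt (by simp)
  have hπ : MDifferentiableAt 𝓘(ℝ, E).tangent 𝓘(ℝ, E) (fun q : TM E M => q.1)
      ((chart p₀).symm z) :=
    ((Bundle.contMDiff_proj (n := ∞) (TangentSpace 𝓘(ℝ, E))) _).mdifferentiableAt (by simp)
  have hψ : MDifferentiableAt 𝓘(ℝ, E) 𝓘(ℝ, E) (extChartAt 𝓘(ℝ, E) p₀.1).symm z.1 :=
    ((contMDiffOn_extChartAt_symm (n := ∞) p₀.1).contMDiffAt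
      ((isOpen_extChartAt_target p₀.1).mem_nhds (mem_chart_target.1 hz))).mdifferentiableAt
      (by simp)
  have hfst : MDifferentiableAt 𝓘(ℝ, E × E) 𝓘(ℝ, E) (Prod.fst : E × E → E) z :=
    differentiableAt_fst.mdifferentiableAt
  have h₁ := mfderiv_comp_apply z hπ hφ u
  have h₂ := mfderiv_comp_apply z hψ hfst u
  rw [mfderiv_eq_fderiv, fderiv_fst] at h₂
  exact h₁.symm.trans h₂

/-- Up to the linear isomorphism `dbase`, the inclusion of a fibre is the affine slice `w ↦ (z.1,
w)` of the chart, whose differential is `w ↦ (0, w)`. -/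
lemma vlift_dbase (hz : z ∈ (chart p₀).target) (w : E) :
    vlift ((chart p₀).symm z) (dbase p₀ z w) = dparam p₀ z (0, w) := by
  let x := ((chart p₀).symm z).1
  obtain ⟨A, hA⟩ := isInvertible_dbase hz
  let A' : E ≃L[ℝ] E := A
  let ι : E → TM E M := fun w => ⟨x, w⟩
  have hmem : ∀ w, (z.1, w) ∈ (chart p₀).target := fun w =>
    mem_chart_target.2 (mem_chart_target.1 hz)
  have hι : ∀ w : E, (chart p₀).symm (z.1, w) = ι (A' w) := fun w => by
    rw [chart_symm_apply (hmem w)]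
    exact congrArg (fun L : E →L[ℝ] E => (⟨x, L w⟩ : TM E M)) hA.symm
  have hz' : (chart p₀).symm z = ι (A' z.2) := hι z.2
  have hslice : ∀ w, HasFDerivAt (fun w : E => (z.1, w)) (ContinuousLinearMap.inr ℝ E E) w :=
    fun w => hasFDerivAt_prodMk_right z.1 w
  have hφ := (contMDiffAt_chart_symm hz).mdifferentiableAt (by simp)
  have hιd : MDifferentiableAt 𝓘(ℝ, E) 𝓘(ℝ, E).tangent ι (A' z.2) := by
    have : ι = (chart p₀).symm ∘ fun w => (z.1, A'.symm w) := by
      funext w; simp [hι]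
    rw [this]
    refine MDifferentiableAt.comp (I' := 𝓘(ℝ, E × E)) _ ?_ ?_
    · simpa using hφ
    · exact ((hslice _).comp _ A'.symm.hasFDerivAt).differentiableAt.mdifferentiableAt
  have h₁ := mfderiv_comp_apply (I := 𝓘(ℝ, E)) z.2 hιd
    A'.differentiableAt.mdifferentiableAt w
  have h₂ := mfderiv_comp_apply (I := 𝓘(ℝ, E)) (f := fun w : E => (z.1, w)) z.2
    (g := (chart p₀).symm) hφ (hslice z.2).differentiableAt.mdifferentiableAt w
  rw [mfderiv_eq_fderiv, (hslice z.2).fderiv] at h₂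
  rw [mfderiv_eq_fderiv, A'.fderiv] at h₁
  have h₃ : (chart p₀).symm ∘ (fun w : E => (z.1, w)) = ι ∘ A' := funext hι
  have h₄ := congrArg (fun f : E → TM E M => (mfderiv 𝓘(ℝ, E) 𝓘(ℝ, E).tangent f z.2 w : E × E)) h₃
  have h₅ : ((chart p₀).symm z).2 = A' z.2 := (snd_chart_symm hz).trans (by rw [← hA]; rfl)
  have h₆ : dbase p₀ z w = A' w := by rw [← hA]; rfl
  rw [vlift, h₅, h₆]
  exact h₁.symm.trans (h₄.symm.trans h₂)

lemma coord_J (hz : z ∈ (chart p₀).target) : coord p₀ (J X) z = (0, (coord p₀ X z).1) := by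
  apply coord_eq_of_dparam hz
  rw [J, ← dparam_coord (X := X) hz, dproj_dparam hz, vlift_dbase hz]

lemma coord_liouville (hz : z ∈ (chart p₀).target) : coord p₀ liouville z = (0, z.2) := by
  apply coord_eq_of_dparam hz
  rw [liouville, ← vlift_dbase hz]
  rw [snd_chart_symm hz]

lemma mem_slit_iff (hz : z ∈ (chart p₀).target) : (chart p₀).symm z ∈ slit E M ↔ z.2 ≠ 0 := by
  obtain ⟨A, hA⟩ := isInvertible_dbase hz
  rw [slit, Set.mem_ofPred_eq, snd_chart_symm hz, ← hA]
  simp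

end

section
variable {E : Type*} [NormedAddCommGroup E] [NormedSpace ℝ E]
  {M : Type*} [TopologicalSpace M] [ChartedSpace E M] [IsManifold 𝓘(ℝ, E) ∞ M]

variable {p₀ : TM E M} {z : E × E} {X Y : VF E M}

/-! ### Smoothness, brackets and derivatives in induced coordinates -/

/-- The vector field that reads `x` in the induced chart around `p₀`. -/
def ofCoord (p₀ : TM E M) (x : E × E → E × E) : VF E M :=
  VectorField.mpullback 𝓘(ℝ, E).tangent 𝓘(ℝ, E × E) (chart p₀) x

lemma isInvertible_mfderiv_chart {q : TM E M} (hq : q ∈ (chart p₀).source) :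
    (mfderiv 𝓘(ℝ, E).tangent 𝓘(ℝ, E × E) (chart p₀) q).IsInvertible :=
  isInvertible_mfderiv_extChartAt hq

lemma mfderiv_chart_dparam (hz : z ∈ (chart p₀).target) (u : E × E) :
    mfderiv 𝓘(ℝ, E).tangent 𝓘(ℝ, E × E) (chart p₀) ((chart p₀).symm z) (dparam p₀ z u) = u := by
  have := mfderiv_extChartAt_comp_mfderivWithin_extChartAt_symm (I := 𝓘(ℝ, E).tangent) hz
  rw [ModelWithCorners.range_eq_univ, mfderivWithin_univ] at this
  exact congrArg (fun L : E × E →L[ℝ] E × E => L u) this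

/-- Supplies test fields with prescribed coordinates. -/
lemma coord_ofCoord (hz : z ∈ (chart p₀).target) (x : E × E → E × E) :
    coord p₀ (ofCoord p₀ x) z = x z := by
  apply coord_eq_of_dparam hz
  have key : ∀ L : TangentSpace 𝓘(ℝ, E).tangent ((chart p₀).symm z) →L[ℝ] E × E,
      L.IsInvertible → ∀ u v, L u = v → L.inverse v = u := by
    rintro _ ⟨e, rfl⟩ u v h
    rw [ContinuousLinearMap.inverse_equiv]
    exact e.symm_apply_eq.2 h.symm
  refine key _ (isInvertible_mfderiv_chart ((chart p₀).map_target hz)) _ _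
    ((mfderiv_chart_dparam hz (x z)).trans ?_)
  rw [(chart p₀).right_inv hz]

lemma ofCoord_coord {q : TM E M} (hq : q ∈ (chart p₀).source) :
    ofCoord p₀ (coord p₀ X) q = X q := by
  have hz := (chart p₀).map_source hq
  have h := (eq_iff_coord_eq (X := ofCoord p₀ (coord p₀ X)) (Y := X) hz).2 (coord_ofCoord hz _)
  rwa [(chart p₀).left_inv hq] at h

section
variable [CompleteSpace E]

lemma contDiffAt_coord (hz : z ∈ (chart p₀).target)
    (hX : ContMDiffAt 𝓘(ℝ, E).tangent 𝓘(ℝ, E).tangent.tangent ∞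
      (fun q => (⟨q, X q⟩ : TangentBundle 𝓘(ℝ, E).tangent (TM E M))) ((chart p₀).symm z)) :
    ContDiffAt ℝ ∞ (coord p₀ X) z := by
  have := ContMDiffAt.mpullback_vectorField_preimage (n := ∞) hX (contMDiffAt_chart_symm hz)
    (isInvertible_dparam hz) (by norm_cast)
  exact contMDiffAt_vectorSpace_iff_contDiffAt.1 this

lemma smoothVFOn_ofCoord {x : E × E → E × E} (hx : ContDiff ℝ ∞ x) :
    SmoothVFOn (chart p₀).source (ofCoord p₀ x : VF E M) := fun q hq =>
  ContMDiffAt.mpullback_vectorField_preimage (n := ∞)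
    (contMDiffAt_vectorSpace_iff_contDiffAt.2 hx.contDiffAt) (contMDiffAt_chart hq)
    (isInvertible_mfderiv_chart hq) (by norm_cast)

lemma mdifferentiableAt_of_coord (hz : z ∈ (chart p₀).target)
    (hX : DifferentiableAt ℝ (coord p₀ X) z) :
    MDifferentiableAt 𝓘(ℝ, E).tangent 𝓘(ℝ, E).tangent.tangent
      (fun q => (⟨q, X q⟩ : TangentBundle 𝓘(ℝ, E).tangent (TM E M))) ((chart p₀).symm z) := by
  have : IsManifold 𝓘(ℝ, E).tangent 2 (TM E M) := IsManifold.of_le (n := ∞) (by norm_cast)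
  have hq := (chart p₀).map_target hz
  have h : MDifferentiableAt 𝓘(ℝ, E × E) 𝓘(ℝ, E × E).tangent
      (fun z => (⟨z, coord p₀ X z⟩ : TangentBundle 𝓘(ℝ, E × E) (E × E)))
      (chart p₀ ((chart p₀).symm z)) := by
    rw [(chart p₀).right_inv hz]
    refine (mdifferentiableAt_section _ _).2 ?_
    simpa using! hX.mdifferentiableAt
  have := MDifferentiableAt.mpullback_vectorField (n := ∞) h (contMDiffAt_chart hq)
    (isInvertible_mfderiv_chart hq) (by norm_cast)
  refine this.congr_of_eventuallyEq ?_
  filter_upwards [isOpen_chart_source.mem_nhds hq] with q' hq'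
  exact congrArg (fun v => (⟨q', v⟩ : TangentBundle 𝓘(ℝ, E).tangent (TM E M)))
    (ofCoord_coord (X := X) hq').symm

lemma coord_bracket (hz : z ∈ (chart p₀).target)
    (hX : DifferentiableAt ℝ (coord p₀ X) z) (hY : DifferentiableAt ℝ (coord p₀ Y) z) :
    coord p₀ (bracket X Y) z =
      fderiv ℝ (coord p₀ Y) z (coord p₀ X z) - fderiv ℝ (coord p₀ X) z (coord p₀ Y z) := by
  have : IsManifold 𝓘(ℝ, E).tangent (minSmoothness ℝ 2) (TM E M) :=
    IsManifold.of_le (n := ∞) (by simp; norm_cast)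
  have h := VectorField.mpullback_mlieBracket (n := ∞) (mdifferentiableAt_of_coord hz hX)
    (mdifferentiableAt_of_coord hz hY) (contMDiffAt_chart_symm hz)
    (by simp; norm_cast)
  rw [← VectorField.mlieBracketWithin_univ, ← VectorField.mlieBracketWithin_univ,
    VectorField.mlieBracketWithin_eq_lieBracketWithin] at h
  exact h.trans (congrFun VectorField.lieBracketWithin_univ z)

end

/-- The function `f` read in the induced chart around `p₀`. -/
def coordFun (p₀ : TM E M) (f : TM E M → ℝ) : E × E → ℝ := f ∘ (chart p₀).symm

lemma coordFun_apply (f : TM E M → ℝ) : coordFun p₀ f z = f ((chart p₀).symm z) := rfl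

lemma contDiffAt_coordFun {f : TM E M → ℝ} (hz : z ∈ (chart p₀).target)
    (hf : ContMDiffAt 𝓘(ℝ, E).tangent 𝓘(ℝ, ℝ) ∞ f ((chart p₀).symm z)) :
    ContDiffAt ℝ ∞ (coordFun p₀ f) z :=
  (hf.comp z (contMDiffAt_chart_symm hz)).contDiffAt

lemma deriv_eq {f : TM E M → ℝ} (hz : z ∈ (chart p₀).target) :
    deriv X f ((chart p₀).symm z) = fderiv ℝ (coordFun p₀ f) z (coord p₀ X z) := by
  have hφ := (contMDiffAt_chart_symm hz).mdifferentiableAt (by simp)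
  have hq := (chart p₀).map_target hz
  by_cases hf : MDifferentiableAt 𝓘(ℝ, E).tangent 𝓘(ℝ, ℝ) f ((chart p₀).symm z)
  · have h := mfderiv_comp_apply z hf hφ (coord p₀ X z)
    rw [deriv, ← dparam_coord (X := X) hz, ← mfderiv_eq_fderiv]
    exact h.symm
  -- Differentiability would transfer back through the chart, so here both derivatives take the
  -- default value 0.
  · have hf' : ¬ DifferentiableAt ℝ (coordFun p₀ f) z := by
      refine fun h => hf ?_
      have h' : MDifferentiableAt 𝓘(ℝ, E × E) 𝓘(ℝ, ℝ) (coordFun p₀ f)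
          (chart p₀ ((chart p₀).symm z)) := by
        rw [(chart p₀).right_inv hz]; exact h.mdifferentiableAt
      refine (h'.comp _ ((contMDiffAt_chart hq).mdifferentiableAt (by simp))).congr_of_eventuallyEq
        ?_
      filter_upwards [isOpen_chart_source.mem_nhds hq] with q hq'
      simp [coordFun, (chart p₀).left_inv hq']
    rw [deriv, mfderiv_zero_of_not_mdifferentiableAt hf, fderiv_zero_of_not_differentiableAt hf']
    rfl

end

/-! ### Sprays in coordinates and second derivatives. -/

section
variable {E : Type*} [NormedAddCommGroup E] [NormedSpace ℝ E]
  {M : Type*} [TopologicalSpace M] [ChartedSpace E M] [IsManifold 𝓘(ℝ, E) ∞ M]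

/-- On the open set `Ω` of the induced chart around `p₀`, the vector field `S` is the smooth
semispray `y^i ∂/∂x^i - 2 G^i ∂/∂y^i`. -/
structure LocalSpray (p₀ : TM E M) (S : VF E M) (Ω : Set (E × E)) (G : E × E → E) : Prop where
  isOpen : IsOpen Ω
  subset : Ω ⊆ (chart p₀).target
  smooth : ∀ z ∈ Ω, ContDiffAt ℝ ∞ G z
  eq : ∀ z ∈ Ω, coord p₀ S z = (z.2, -(2 : ℝ) • G z)

/-- The vector field `X` is smooth on the set `Ω` of the induced chart around `p₀`. -/
def SmoothCoordOn (p₀ : TM E M) (Ω : Set (E × E)) (X : VF E M) : Prop :=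
  ∀ z ∈ Ω, ContDiffAt ℝ ∞ (coord p₀ X) z

/-- The coefficients `N = ∂G/∂y` of the nonlinear connection. -/
def conn (G : E × E → E) (z : E × E) : E →L[ℝ] E :=
  (fderiv ℝ G z).comp (ContinuousLinearMap.inr ℝ E E)

/-- The coefficients of the Jacobi endomorphism. -/
def jacobiCoeff (G : E × E → E) (z : E × E) : E →L[ℝ] E :=
  (2 : ℝ) • (fderiv ℝ G z).comp (ContinuousLinearMap.inl ℝ E E)
    - (fderiv ℝ (fderiv ℝ G) z (z.2, -(2 : ℝ) • G z)).comp (ContinuousLinearMap.inr ℝ E E)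
    - (conn G z).comp (conn G z)

lemma differentiableAt_of_smooth {A B : Type*} [NormedAddCommGroup A] [NormedSpace ℝ A]
    [NormedAddCommGroup B] [NormedSpace ℝ B] {f : A → B} {a : A} (hf : ContDiffAt ℝ ∞ f a) :
    DifferentiableAt ℝ f a := hf.differentiableAt (by simp)

lemma contDiffAt_fderiv {A B : Type*} [NormedAddCommGroup A] [NormedSpace ℝ A]
    [NormedAddCommGroup B] [NormedSpace ℝ B] {f : A → B} {a : A} (hf : ContDiffAt ℝ ∞ f a) :
    ContDiffAt ℝ ∞ (fderiv ℝ f) a := hf.fderiv_right (by norm_cast)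

lemma hasFDerivAt_fderiv {A B : Type*} [NormedAddCommGroup A] [NormedSpace ℝ A]
    [NormedAddCommGroup B] [NormedSpace ℝ B] {f : A → B} {a : A} (hf : ContDiffAt ℝ ∞ f a) :
    HasFDerivAt (fderiv ℝ f) (fderiv ℝ (fderiv ℝ f) a) a :=
  (differentiableAt_of_smooth (contDiffAt_fderiv hf)).hasFDerivAt

lemma contDiffAt_conn {G : E × E → E} {z : E × E} (hG : ContDiffAt ℝ ∞ G z) :
    ContDiffAt ℝ ∞ (conn G) z :=
  (contDiffAt_fderiv hG).clm_comp contDiffAt_const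

lemma fderiv_fderiv_apply {A B : Type*} [NormedAddCommGroup A] [NormedSpace ℝ A]
    [NormedAddCommGroup B] [NormedSpace ℝ B] {f : A → B} {a : A} (hf : ContDiffAt ℝ ∞ f a)
    {x : A → A} {x' : A →L[ℝ] A} (hx : HasFDerivAt x x' a) (u : A) :
    fderiv ℝ (fun w => fderiv ℝ f w (x w)) a u =
      fderiv ℝ (fderiv ℝ f) a u (x a) + fderiv ℝ f a (x' u) := by
  rw [((hasFDerivAt_fderiv hf).clm_apply hx).fderiv]
  simp [add_comm]

lemma fderiv_fderiv_symm {A B : Type*} [NormedAddCommGroup A] [NormedSpace ℝ A]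
    [NormedAddCommGroup B] [NormedSpace ℝ B] {f : A → B} {a : A} (hf : ContDiffAt ℝ ∞ f a)
    (u v : A) : fderiv ℝ (fderiv ℝ f) a u v = fderiv ℝ (fderiv ℝ f) a v u :=
  hf.isSymmSndFDerivAt (by simp; norm_cast) u v

end

/-! ### Horizontal projector, curvature and Jacobi endomorphism in coordinates. -/

section
variable {E : Type*} [NormedAddCommGroup E] [NormedSpace ℝ E] [CompleteSpace E]
  {M : Type*} [TopologicalSpace M] [ChartedSpace E M] [IsManifold 𝓘(ℝ, E) ∞ M]
  {p₀ : TM E M} {S : VF E M} {Ω : Set (E × E)} {G : E × E → E} {X Y : VF E M} {z : E × E}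

omit [CompleteSpace E] in
lemma LocalSpray.smoothCoordOn (h : LocalSpray p₀ S Ω G) : SmoothCoordOn p₀ Ω S := fun z hz => by
  have h' : ContDiffAt ℝ ∞ (fun z : E × E => (z.2, -(2 : ℝ) • G z)) z :=
    contDiffAt_snd.prodMk ((h.smooth z hz).const_smul _)
  refine h'.congr_of_eventuallyEq ?_
  filter_upwards [h.isOpen.mem_nhds hz] with w hw using h.eq w hw

omit [CompleteSpace E] in
lemma LocalSpray.fderiv_coord (h : LocalSpray p₀ S Ω G) (hz : z ∈ Ω) (u : E × E) :
    fderiv ℝ (coord p₀ S) z u = (u.2, -(2 : ℝ) • fderiv ℝ G z u) := by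
  have h' : HasFDerivAt (fun z : E × E => (z.2, -(2 : ℝ) • G z))
      ((ContinuousLinearMap.snd ℝ E E).prod (-(2 : ℝ) • fderiv ℝ G z)) z :=
    hasFDerivAt_snd.prodMk ((differentiableAt_of_smooth (h.smooth z hz)).hasFDerivAt.const_smul _)
  have h'' : coord p₀ S =ᶠ[𝓝 z] fun z : E × E => (z.2, -(2 : ℝ) • G z) := by
    filter_upwards [h.isOpen.mem_nhds hz] with w hw using h.eq w hw
  rw [h''.fderiv_eq, h'.fderiv]
  rfl

omit [CompleteSpace E] in
lemma SmoothCoordOn.J (h : LocalSpray p₀ S Ω G) (hX : SmoothCoordOn p₀ Ω X) :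
    SmoothCoordOn p₀ Ω (J X) := fun z hz => by
  have h' : ContDiffAt ℝ ∞ (fun z : E × E => ((0 : E), (coord p₀ X z).1)) z :=
    contDiffAt_const.prodMk (hX z hz).fst
  refine h'.congr_of_eventuallyEq ?_
  filter_upwards [h.isOpen.mem_nhds hz] with w hw using coord_J (h.subset hw)

omit [CompleteSpace E] in
lemma fderiv_coord_J (h : LocalSpray p₀ S Ω G) (hX : SmoothCoordOn p₀ Ω X) (hz : z ∈ Ω)
    (u : E × E) :
    fderiv ℝ (coord p₀ (J X)) z u = (0, (fderiv ℝ (coord p₀ X) z u).1) := by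
  have h' : HasFDerivAt (fun z : E × E => ((0 : E), (coord p₀ X z).1))
      ((0 : E × E →L[ℝ] E).prod ((ContinuousLinearMap.fst ℝ E E).comp
        (fderiv ℝ (coord p₀ X) z))) z :=
    (hasFDerivAt_const (0 : E) z).prodMk (differentiableAt_of_smooth (hX z hz)).hasFDerivAt.fst
  have h'' : coord p₀ (J X) =ᶠ[𝓝 z] fun z : E × E => ((0 : E), (coord p₀ X z).1) := by
    filter_upwards [h.isOpen.mem_nhds hz] with w hw using coord_J (h.subset hw)
  rw [h''.fderiv_eq, h'.fderiv]
  rfl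

lemma LocalSpray.coord_bracket (h : LocalSpray p₀ S Ω G) (hX : SmoothCoordOn p₀ Ω X)
    (hY : SmoothCoordOn p₀ Ω Y) (hz : z ∈ Ω) : coord p₀ (bracket X Y) z =
      fderiv ℝ (coord p₀ Y) z (coord p₀ X z) - fderiv ℝ (coord p₀ X) z (coord p₀ Y z) :=
  SprayGeometry.coord_bracket (h.subset hz) (differentiableAt_of_smooth (hX z hz))
    (differentiableAt_of_smooth (hY z hz))

lemma SmoothCoordOn.bracket (h : LocalSpray p₀ S Ω G) (hX : SmoothCoordOn p₀ Ω X)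
    (hY : SmoothCoordOn p₀ Ω Y) : SmoothCoordOn p₀ Ω (bracket X Y) := fun z hz => by
  have h' : ContDiffAt ℝ ∞ (fun z => fderiv ℝ (coord p₀ Y) z (coord p₀ X z) -
      fderiv ℝ (coord p₀ X) z (coord p₀ Y z)) z :=
    ((contDiffAt_fderiv (hY z hz)).clm_apply (hX z hz)).sub
      ((contDiffAt_fderiv (hX z hz)).clm_apply (hY z hz))
  refine h'.congr_of_eventuallyEq ?_
  filter_upwards [h.isOpen.mem_nhds hz] with w hw using h.coord_bracket hX hY hw

lemma LocalSpray.coord_bracketVFEnd_J (h : LocalSpray p₀ S Ω G) (hX : SmoothCoordOn p₀ Ω X)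
    (hz : z ∈ Ω) : coord p₀ (bracketVFEnd S SprayGeometry.J X) z =
      (-(coord p₀ X z).1, (coord p₀ X z).2 + (2 : ℝ) • conn G z (coord p₀ X z).1) := by
  rw [bracketVFEnd, coord_sub, h.coord_bracket h.smoothCoordOn (hX.J h) hz, coord_J (h.subset hz),
    coord_J (h.subset hz), h.coord_bracket h.smoothCoordOn hX hz, fderiv_coord_J h hX hz,
    h.fderiv_coord hz, h.fderiv_coord hz]
  ext
  · simp
  · simpa [conn] using add_comm _ _

lemma LocalSpray.coord_hor (h : LocalSpray p₀ S Ω G) (hX : SmoothCoordOn p₀ Ω X) (hz : z ∈ Ω) :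
    coord p₀ (hor S X) z = ((coord p₀ X z).1, -conn G z (coord p₀ X z).1) := by
  rw [hor, coord_smul, coord_sub, h.coord_bracketVFEnd_J hX hz]
  ext
  · simp only [Prod.smul_fst, Prod.fst_sub]; module
  · simp only [Prod.smul_snd, Prod.snd_sub]; module

lemma LocalSpray.coord_ver (h : LocalSpray p₀ S Ω G) (hX : SmoothCoordOn p₀ Ω X) (hz : z ∈ Ω) :
    coord p₀ (ver S X) z = (0, (coord p₀ X z).2 + conn G z (coord p₀ X z).1) := by
  rw [ver, coord_smul, coord_add, h.coord_bracketVFEnd_J hX hz]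
  ext
  · simp only [Prod.smul_fst, Prod.fst_add]; module
  · simp only [Prod.smul_snd, Prod.snd_add]; module

lemma SmoothCoordOn.hor (h : LocalSpray p₀ S Ω G) (hX : SmoothCoordOn p₀ Ω X) :
    SmoothCoordOn p₀ Ω (hor S X) := fun z hz => by
  have h' : ContDiffAt ℝ ∞ (fun z => ((coord p₀ X z).1, -conn G z (coord p₀ X z).1)) z :=
    (hX z hz).fst.prodMk ((contDiffAt_conn (h.smooth z hz)).clm_apply (hX z hz).fst).neg
  refine h'.congr_of_eventuallyEq ?_
  filter_upwards [h.isOpen.mem_nhds hz] with w hw using h.coord_hor hX hw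

lemma LocalSpray.fderiv_coord_hor (h : LocalSpray p₀ S Ω G) (hX : SmoothCoordOn p₀ Ω X)
    (hz : z ∈ Ω) (u : E × E) :
    fderiv ℝ (coord p₀ (SprayGeometry.hor S X)) z u = ((fderiv ℝ (coord p₀ X) z u).1,
      -(fderiv ℝ (fderiv ℝ G) z u (0, (coord p₀ X z).1) +
        conn G z (fderiv ℝ (coord p₀ X) z u).1)) := by
  have hx := (differentiableAt_of_smooth (hX z hz)).hasFDerivAt
  have hx' : HasFDerivAt (fun z : E × E => ((0 : E), (coord p₀ X z).1))
      ((0 : E × E →L[ℝ] E).prod ((ContinuousLinearMap.fst ℝ E E).comp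
        (fderiv ℝ (coord p₀ X) z))) z :=
    (hasFDerivAt_const (0 : E) z).prodMk hx.fst
  have h' : HasFDerivAt (fun z => ((coord p₀ X z).1, -fderiv ℝ G z (0, (coord p₀ X z).1))) _ z :=
    hx.fst.prodMk ((hasFDerivAt_fderiv (h.smooth z hz)).clm_apply hx').neg
  have h'' : coord p₀ (SprayGeometry.hor S X) =ᶠ[𝓝 z] fun z => ((coord p₀ X z).1,
      -fderiv ℝ G z (0, (coord p₀ X z).1)) := by
    filter_upwards [h.isOpen.mem_nhds hz] with w hw
    rw [h.coord_hor hX hw]; rfl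
  rw [h''.fderiv_eq, h'.fderiv]
  simp [conn, add_comm]

/-- The derivatives of `X` and `Y` cancel by tensoriality, leaving the derivatives of N along
horizontal lifts. -/
lemma LocalSpray.coord_curvature (h : LocalSpray p₀ S Ω G) (hX : SmoothCoordOn p₀ Ω X)
    (hY : SmoothCoordOn p₀ Ω Y) (hz : z ∈ Ω) : coord p₀ (curvature S X Y) z =
      (0, fderiv ℝ (fderiv ℝ G) z ((coord p₀ Y z).1, -conn G z (coord p₀ Y z).1)
            (0, (coord p₀ X z).1) -
          fderiv ℝ (fderiv ℝ G) z ((coord p₀ X z).1, -conn G z (coord p₀ X z).1)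
            (0, (coord p₀ Y z).1)) := by
  have hXY := hX.bracket h hY
  have hX' := hX.hor h
  have hY' := hY.hor h
  rw [curvature, bracketEndEnd]
  simp only [coord_smul, coord_add, coord_sub, h.coord_bracket hX' hY' hz,
    h.coord_hor (hXY.hor h) hz, h.coord_hor hXY hz, h.coord_bracket hX hY hz,
    h.coord_hor (hX'.bracket h hY) hz, h.coord_hor (hX.bracket h hY') hz,
    h.coord_bracket hX' hY hz, h.coord_bracket hX hY' hz,
    h.fderiv_coord_hor hX hz, h.fderiv_coord_hor hY hz, h.coord_hor hX hz, h.coord_hor hY hz]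
  ext
  · simp only [Prod.smul_fst, Prod.fst_add, Prod.fst_sub]; module
  · simp only [Prod.smul_snd, Prod.snd_add, Prod.snd_sub, Prod.fst_sub, map_sub]; module

lemma LocalSpray.coord_jacobi (h : LocalSpray p₀ S Ω G) (hX : SmoothCoordOn p₀ Ω X)
    (hz : z ∈ Ω) :
    coord p₀ (jacobi S X) z = (0, jacobiCoeff G z (coord p₀ X z).1) := by
  have hX' := hX.hor h
  have hS := h.smoothCoordOn
  have hK : SmoothCoordOn p₀ Ω (bracketVFEnd S (SprayGeometry.hor S) X) := by
    intro w hw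
    have := ((hS.bracket h hX') w hw).sub (((hS.bracket h hX).hor h) w hw)
    refine this.congr_of_eventuallyEq (Eventually.of_forall fun w => ?_)
    exact coord_sub
  rw [jacobi, h.coord_ver hK hz, bracketVFEnd]
  simp only [coord_sub, h.coord_bracket hS hX' hz, h.coord_hor (hS.bracket h hX) hz,
    h.coord_bracket hS hX hz, h.fderiv_coord_hor hX hz, h.coord_hor hX hz, h.fderiv_coord hz,
    h.eq z hz]
  -- Splits off the vertical part, so that the horizontal lift produces the term N² of the Jacobi
  -- endomorphism.
  have e1 : ∀ a b : E, fderiv ℝ G z (a, b) = fderiv ℝ G z (a, 0) + conn G z b := fun a b => by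
    rw [conn, ContinuousLinearMap.comp_apply, ← map_add]; simp
  ext
  · rfl
  · simp only [Prod.snd_sub, Prod.fst_sub, map_sub, map_neg,
      e1 (coord p₀ X z).1 (-conn G z (coord p₀ X z).1)]
    simp [jacobiCoeff]
    module
end

/-! ### Trace, Euler–Lagrange form, d_J d_h P and W₁ in coordinates. -/

section
variable {E : Type*} [NormedAddCommGroup E] [NormedSpace ℝ E] [CompleteSpace E]
  {M : Type*} [TopologicalSpace M] [ChartedSpace E M] [IsManifold 𝓘(ℝ, E) ∞ M]
  {p₀ : TM E M} {S : VF E M} {Ω : Set (E × E)} {G : E × E → E} {X Y : VF E M} {z : E × E}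

omit [CompleteSpace E] in
lemma LocalSpray.mono (h : LocalSpray p₀ S Ω G) {Ω' : Set (E × E)} (ho : IsOpen Ω')
    (hs : Ω' ⊆ Ω) : LocalSpray p₀ S Ω' G :=
  ⟨ho, hs.trans h.subset, fun z hz => h.smooth z (hs hz), fun z hz => h.eq z (hs hz)⟩

lemma smoothNear_ofCoord {q : TM E M} (hq : q ∈ (chart p₀).source) {x : E × E → E × E}
    (hx : ContDiff ℝ ∞ x) : SmoothNear q (ofCoord p₀ x) :=
  ⟨_, isOpen_chart_source, hq, smoothVFOn_ofCoord hx⟩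

lemma exists_smoothCoordOn (hΩ : IsOpen Ω) (hΩt : Ω ⊆ (chart p₀).target) (hz : z ∈ Ω)
    (hX : SmoothNear ((chart p₀).symm z) X) :
    ∃ Ω' ⊆ Ω, IsOpen Ω' ∧ z ∈ Ω' ∧ SmoothCoordOn p₀ Ω' X := by
  obtain ⟨U, hU, hzU, hXU⟩ := hX
  have hc : ContinuousOn (chart p₀).symm Ω := (continuousOn_extChartAt_symm p₀).mono hΩt
  refine ⟨Ω ∩ (chart p₀).symm ⁻¹' U, Set.inter_subset_left, hc.isOpen_inter_preimage hΩ hU,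
    ⟨hz, hzU⟩, fun w hw => contDiffAt_coord (hΩt hw.1) (hXU _ hw.2)⟩

/-- Testing on fields with constant coordinates and using injectivity of the vertical lift shows
that a representing endomorphism is unique. -/
lemma Represents.apply_dbase (h : LocalSpray p₀ S Ω G) (hz : z ∈ Ω)
    {A : TangentSpace 𝓘(ℝ, E) ((chart p₀).symm z).1 →ₗ[ℝ]
      TangentSpace 𝓘(ℝ, E) ((chart p₀).symm z).1}
    (hA : Represents (jacobi S) ((chart p₀).symm z) A) (a : E) :
    A (dbase p₀ z a) = dbase p₀ z (jacobiCoeff G z a) := by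
  have hzt := h.subset hz
  have hx : ContDiff ℝ ∞ fun _ : E × E => (a, (0 : E)) := contDiff_const
  obtain ⟨Ω', hΩ', ho, hz', hX⟩ := exists_smoothCoordOn h.isOpen h.subset hz
    (smoothNear_ofCoord ((chart p₀).map_target hzt) hx)
  have h₁ := hA _ (smoothNear_ofCoord ((chart p₀).map_target hzt) hx)
  rw [← dparam_coord (X := jacobi S _) hzt, (h.mono ho hΩ').coord_jacobi hX hz', ← vlift_dbase hzt,
    ← dparam_coord (X := ofCoord _ _) hzt, dproj_dparam hzt, coord_ofCoord hzt] at h₁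
  obtain ⟨B, hB⟩ := isInvertible_dbase hzt
  obtain ⟨D, hD⟩ := isInvertible_dparam hzt
  obtain ⟨b, hb⟩ := B.surjective (A (dbase p₀ z a))
  have hb' : dbase p₀ z b = A (dbase p₀ z a) := by rw [← hb, ← hB]; rfl
  rw [← hb', vlift_dbase hzt, vlift_dbase hzt, ← hD] at h₁
  have h₂ : jacobiCoeff G z a = b := (Prod.ext_iff.1 (D.injective h₁)).2
  rw [← hb', h₂]

/-- The coefficient matrix conjugated by `dbase` is a representing endomorphism, so `trace` is not
its default value; by uniqueness it is the chosen one, and conjugation preserves the trace. -/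
lemma LocalSpray.trace_jacobi (h : LocalSpray p₀ S Ω G) (hz : z ∈ Ω) :
    trace (jacobi S) ((chart p₀).symm z) = LinearMap.trace ℝ E (jacobiCoeff G z) := by
  have hzt := h.subset hz
  obtain ⟨B, hB⟩ := isInvertible_dbase hzt
  have hB' : ∀ a, dbase p₀ z a = B.toLinearEquiv a := fun a => by rw [← hB]; rfl
  have hex : ∃ A, Represents (jacobi S) ((chart p₀).symm z) A := by
    refine ⟨B.toLinearEquiv.conj (jacobiCoeff G z).toLinearMap, fun X hX => ?_⟩
    obtain ⟨Ω', hΩ', ho, hz', hX⟩ := exists_smoothCoordOn h.isOpen h.subset hz hX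
    rw [← dparam_coord (X := jacobi S _) hzt, (h.mono ho hΩ').coord_jacobi hX hz', ← vlift_dbase hzt,
      ← dparam_coord (X := X) hzt, dproj_dparam hzt, hB', hB', LinearEquiv.conj_apply_apply,
      LinearEquiv.symm_apply_apply]
    rfl
  rw [trace, dif_pos hex]
  have hA : hex.choose = B.toLinearEquiv.conj (jacobiCoeff G z).toLinearMap := by
    ext v
    obtain ⟨a, rfl⟩ := B.toLinearEquiv.surjective v
    rw [← hB', Represents.apply_dbase h hz hex.choose_spec, hB', hB', LinearEquiv.conj_apply_apply,
      LinearEquiv.symm_apply_apply]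
    rfl
  rw [hA, LinearMap.trace_conj']

/-- The coefficients of the Euler–Lagrange form. -/
def eulerLagrangeCoeff (G : E × E → E) (p : E × E → ℝ) (z : E × E) (a : E) : ℝ :=
  fderiv ℝ (fderiv ℝ p) z (z.2, -(2 : ℝ) • G z) (0, a) - fderiv ℝ p z (a, 0)

/-- The coefficients of `d_J d_h P`. -/
def dJdhCoeff (G : E × E → E) (p : E × E → ℝ) (z : E × E) (a b : E) : ℝ :=
  fderiv ℝ (fderiv ℝ p) z (0, a) (b, -conn G z b) -
    fderiv ℝ (fderiv ℝ p) z (0, b) (a, -conn G z a)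

variable {P : TM E M → ℝ}

/-- δ_S P is semi-basic: the vertical component of `X` and the derivatives of `X` cancel. -/
lemma LocalSpray.eulerLagrange_eq (h : LocalSpray p₀ S Ω G) (hX : SmoothCoordOn p₀ Ω X)
    (hP : ∀ z ∈ Ω, ContDiffAt ℝ ∞ (coordFun p₀ P) z) (hz : z ∈ Ω) :
    eulerLagrange S P X ((chart p₀).symm z) =
      eulerLagrangeCoeff G (coordFun p₀ P) z (coord p₀ X z).1 := by
  have hzt := h.subset hz
  have h₁ : coordFun p₀ (dEnd J P X) =ᶠ[𝓝 z]
      fun w => fderiv ℝ (coordFun p₀ P) w (0, (coord p₀ X w).1) := by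
    filter_upwards [h.isOpen.mem_nhds hz] with w hw
    rw [coordFun_apply, dEnd, deriv_eq (h.subset hw), coord_J (h.subset hw)]
  have hx' : HasFDerivAt (fun z : E × E => ((0 : E), (coord p₀ X z).1))
      ((0 : E × E →L[ℝ] E).prod ((ContinuousLinearMap.fst ℝ E E).comp
        (fderiv ℝ (coord p₀ X) z))) z :=
    (hasFDerivAt_const (0 : E) z).prodMk (differentiableAt_of_smooth (hX z hz)).hasFDerivAt.fst
  rw [eulerLagrange, Pi.sub_apply, lieForm, Pi.sub_apply, deriv_eq hzt, h₁.fderiv_eq,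
    fderiv_fderiv_apply (hP z hz) hx', dEnd, deriv_eq hzt, coord_J hzt,
    h.coord_bracket h.smoothCoordOn hX hz, deriv_eq hzt, h.fderiv_coord hz, h.eq z hz,
    eulerLagrangeCoeff]
  have e : fderiv ℝ (coordFun p₀ P) z (coord p₀ X z) =
      fderiv ℝ (coordFun p₀ P) z ((coord p₀ X z).1, 0) +
        fderiv ℝ (coordFun p₀ P) z (0, (coord p₀ X z).2) := by
    rw [← map_add]; simp
  have e' : ∀ a b : E, fderiv ℝ (coordFun p₀ P) z (0, a - b) =
      fderiv ℝ (coordFun p₀ P) z (0, a) - fderiv ℝ (coordFun p₀ P) z (0, b) := fun a b => by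
    rw [← map_sub]; simp
  rw [e, Prod.fst_sub, e']
  simp only [ContinuousLinearMap.prod_apply, zero_apply,
    ContinuousLinearMap.comp_apply, ContinuousLinearMap.coe_fst']
  ring

lemma LocalSpray.dEndForm_eq (h : LocalSpray p₀ S Ω G) (hX : SmoothCoordOn p₀ Ω X)
    (hY : SmoothCoordOn p₀ Ω Y)
    (hP : ∀ z ∈ Ω, ContDiffAt ℝ ∞ (coordFun p₀ P) z) (hz : z ∈ Ω) :
    dEndForm J (dEnd (hor S) P) X Y ((chart p₀).symm z) =
      dJdhCoeff G (coordFun p₀ P) z (coord p₀ X z).1 (coord p₀ Y z).1 := by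
  have hzt := h.subset hz
  have h₁ : ∀ {Z : VF E M}, SmoothCoordOn p₀ Ω Z → ∀ u,
      fderiv ℝ (coordFun p₀ (dEnd (hor S) P Z)) z u =
      fderiv ℝ (fderiv ℝ (coordFun p₀ P)) z u ((coord p₀ Z z).1, -conn G z (coord p₀ Z z).1) +
        fderiv ℝ (coordFun p₀ P) z (fderiv ℝ (coord p₀ (hor S Z)) z u) := by
    intro Z hZ u
    have h₂ : coordFun p₀ (dEnd (hor S) P Z) =ᶠ[𝓝 z]
        fun w => fderiv ℝ (coordFun p₀ P) w (coord p₀ (hor S Z) w) := by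
      filter_upwards [h.isOpen.mem_nhds hz] with w hw
      rw [coordFun_apply, dEnd, deriv_eq (h.subset hw)]
    rw [h₂.fderiv_eq, fderiv_fderiv_apply (hP z hz)
      (differentiableAt_of_smooth ((hZ.hor h) z hz)).hasFDerivAt, h.coord_hor hZ hz]
  have hJX := hX.J h
  have hJY := hY.J h
  -- The symmetry of ∂²G/∂y∂y, that is, the vanishing of the torsion [J, h].
  have hsymm := fderiv_fderiv_symm (h.smooth z hz) (0, (coord p₀ X z).1) (0, (coord p₀ Y z).1)
  simp only [dEndForm, Pi.sub_apply, Pi.add_apply]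
  rw [deriv_eq hzt, deriv_eq hzt, h₁ hX, h₁ hY]
  simp only [dEnd, deriv_eq hzt, coord_J hzt, h.coord_hor (hJX.bracket h hY) hz,
    h.coord_hor (hX.bracket h hJY) hz, h.coord_hor ((hX.bracket h hY).J h) hz,
    h.coord_bracket hJX hY hz, h.coord_bracket hX hJY hz, fderiv_coord_J h hX hz,
    fderiv_coord_J h hY hz, h.fderiv_coord_hor hX hz, h.fderiv_coord_hor hY hz, hsymm]
  rw [dJdhCoeff]
  -- The first derivatives of P occur as one linear form applied to several vectors; it suffices
  -- that their signed sum is zero.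
  have key : ∀ (A B : ℝ) (v₁ v₂ v₃ v₄ v₅ : E × E), v₁ - v₂ - v₃ - v₄ + v₅ = 0 →
      (A + fderiv ℝ (coordFun p₀ P) z v₁) - (B + fderiv ℝ (coordFun p₀ P) z v₂)
        - fderiv ℝ (coordFun p₀ P) z v₃ - fderiv ℝ (coordFun p₀ P) z v₄
        + fderiv ℝ (coordFun p₀ P) z v₅ = A - B := by
    intro A B v₁ v₂ v₃ v₄ v₅ hv
    have := congrArg (fderiv ℝ (coordFun p₀ P) z) hv
    simp only [map_sub, map_add, map_zero] at this
    linarith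
  refine key _ _ _ _ _ _ _ ?_
  ext
  · simp
  · simp only [Prod.snd_sub, Prod.snd_add, Prod.fst_sub, map_sub, map_zero, Prod.snd_zero]
    module

omit [CompleteSpace E] in
lemma coord_wedge (α : VF E M → TM E M → ℝ) (K : VF E M → VF E M) :
    coord p₀ (wedge α K X Y) z = α X ((chart p₀).symm z) • coord p₀ (K Y) z -
      α Y ((chart p₀).symm z) • coord p₀ (K X) z := by
  simp only [coord_apply, wedge, map_sub, map_smul]

omit [CompleteSpace E] in
lemma coord_tensor (θ : VF E M → VF E M → TM E M → ℝ) (Z : VF E M) :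
    coord p₀ (tensor θ Z X Y) z = θ X Y ((chart p₀).symm z) • coord p₀ Z z := by
  simp only [coord_apply, tensor, map_smul]

omit [CompleteSpace E] in
lemma coord_deform : coord p₀ (deform S P) z =
    coord p₀ S z - (2 * coordFun p₀ P z) • coord p₀ liouville z := by
  simp only [coord_apply, deform, map_sub, map_smul, coordFun_apply]

lemma LocalSpray.coord_weyl [FiniteDimensional ℝ E] (h : LocalSpray p₀ S Ω G)
    (hX : SmoothCoordOn p₀ Ω X) (hY : SmoothCoordOn p₀ Ω Y) (hz : z ∈ Ω) :
    coord p₀ (weyl S X Y) z = (0, (coord p₀ (curvature S X Y) z).2 -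
      (1 / (2 * ((Module.finrank ℝ E : ℝ) - 1))) •
        (fderiv ℝ (fun w => LinearMap.trace ℝ E (jacobiCoeff G w)) z (0, (coord p₀ X z).1) •
            (coord p₀ Y z).1 -
          fderiv ℝ (fun w => LinearMap.trace ℝ E (jacobiCoeff G w)) z (0, (coord p₀ Y z).1) •
            (coord p₀ X z).1)) := by
  have hzt := h.subset hz
  have h₁ : coordFun p₀ (trace (jacobi S)) =ᶠ[𝓝 z]
      fun w => LinearMap.trace ℝ E (jacobiCoeff G w) := by
    filter_upwards [h.isOpen.mem_nhds hz] with w hw using h.trace_jacobi hw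
  have h₂ : coord p₀ (wedge (dEnd J (trace (jacobi S))) J X Y) z =
      (0, fderiv ℝ (fun w => LinearMap.trace ℝ E (jacobiCoeff G w)) z (0, (coord p₀ X z).1) •
            (coord p₀ Y z).1 -
          fderiv ℝ (fun w => LinearMap.trace ℝ E (jacobiCoeff G w)) z (0, (coord p₀ Y z).1) •
            (coord p₀ X z).1) := by
    have h₃ : ∀ Z : VF E M, dEnd J (trace (jacobi S)) Z ((chart p₀).symm z) =
        fderiv ℝ (fun w => LinearMap.trace ℝ E (jacobiCoeff G w)) z (0, (coord p₀ Z z).1) :=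
      fun Z => by rw [dEnd, deriv_eq hzt, h₁.fderiv_eq, coord_J hzt]
    rw [coord_wedge, h₃, h₃, coord_J hzt, coord_J hzt]
    ext <;> simp
  rw [weyl, coord_sub, coord_smul, h₂, h.coord_curvature hX hY hz]
  ext <;> simp

end

section
variable {E : Type*} [NormedAddCommGroup E] [NormedSpace ℝ E]
  {G : E × E → E} {p : E × E → ℝ} {z : E × E} {Ω : Set (E × E)}

/-! ### Projective deformations in coordinates -/

/-- The coefficients of the spray `S - 2 P C`. -/
def deformCoeff (G : E × E → E) (p : E × E → ℝ) (z : E × E) : E := G z + p z • z.2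

lemma contDiffAt_deformCoeff (hG : ContDiffAt ℝ ∞ G z) (hp : ContDiffAt ℝ ∞ p z) :
    ContDiffAt ℝ ∞ (deformCoeff G p) z := hG.add (hp.smul contDiffAt_snd)

lemma fderiv_deformCoeff (hG : ContDiffAt ℝ ∞ G z) (hp : ContDiffAt ℝ ∞ p z) (u : E × E) :
    fderiv ℝ (deformCoeff G p) z u =
      fderiv ℝ G z u + fderiv ℝ p z u • z.2 + p z • u.2 := by
  have h : HasFDerivAt (deformCoeff G p) _ z :=
    (differentiableAt_of_smooth hG).hasFDerivAt.add
      ((differentiableAt_of_smooth hp).hasFDerivAt.smul hasFDerivAt_snd)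
  rw [h.fderiv]
  simp
  abel

lemma conn_deformCoeff (hG : ContDiffAt ℝ ∞ G z) (hp : ContDiffAt ℝ ∞ p z) (a : E) :
    conn (deformCoeff G p) z a = conn G z a + fderiv ℝ p z (0, a) • z.2 + p z • a :=
  fderiv_deformCoeff hG hp (0, a)

/-- A second derivative is the derivative of a first derivative in a fixed direction. -/
lemma fderiv_fderiv_const {A B : Type*} [NormedAddCommGroup A] [NormedSpace ℝ A]
    [NormedAddCommGroup B] [NormedSpace ℝ B] {f : A → B} {a : A} (hf : ContDiffAt ℝ ∞ f a)
    (u v : A) :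
    fderiv ℝ (fderiv ℝ f) a u v = fderiv ℝ (fun w => fderiv ℝ f w v) a u := by
  rw [fderiv_fderiv_apply hf (hasFDerivAt_const v a)]; simp

lemma fderiv_fderiv_deformCoeff (hΩ : IsOpen Ω) (hz : z ∈ Ω) (hG : ∀ z ∈ Ω, ContDiffAt ℝ ∞ G z)
    (hp : ∀ z ∈ Ω, ContDiffAt ℝ ∞ p z) (u v : E × E) :
    fderiv ℝ (fderiv ℝ (deformCoeff G p)) z u v =
      fderiv ℝ (fderiv ℝ G) z u v + fderiv ℝ (fderiv ℝ p) z u v • z.2 +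
        fderiv ℝ p z v • u.2 + fderiv ℝ p z u • v.2 := by
  rw [fderiv_fderiv_const (contDiffAt_deformCoeff (hG z hz) (hp z hz))]
  have h₁ : (fun w => fderiv ℝ (deformCoeff G p) w v) =ᶠ[𝓝 z] fun w =>
      fderiv ℝ G w v + fderiv ℝ p w v • w.2 + p w • v.2 := by
    filter_upwards [hΩ.mem_nhds hz] with w hw using fderiv_deformCoeff (hG w hw) (hp w hw) v
  have h₂ : HasFDerivAt (fun w => fderiv ℝ G w v + fderiv ℝ p w v • w.2 + p w • v.2) _ z :=
    (((hasFDerivAt_fderiv (hG z hz)).clm_apply (hasFDerivAt_const v z)).add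
      (((hasFDerivAt_fderiv (hp z hz)).clm_apply (hasFDerivAt_const v z)).smul
        hasFDerivAt_snd)).add
      ((differentiableAt_of_smooth (hp z hz)).hasFDerivAt.smul_const v.2)
  rw [h₁.fderiv_eq, h₂.fderiv]
  simp
  abel

/-- `G` and `p` are smooth on the open set `Ω`, positively homogeneous in the fibre variable of
degrees `2` and `1`. -/
structure HomogeneousPair (Ω : Set (E × E)) (G : E × E → E) (p : E × E → ℝ) : Prop where
  isOpen : IsOpen Ω
  smooth : ∀ z ∈ Ω, ContDiffAt ℝ ∞ G z
  smooth' : ∀ z ∈ Ω, ContDiffAt ℝ ∞ p z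
  euler : ∀ z ∈ Ω, fderiv ℝ G z (0, z.2) = (2 : ℝ) • G z
  euler' : ∀ z ∈ Ω, fderiv ℝ p z (0, z.2) = p z

lemma hasFDerivAt_inr_snd : HasFDerivAt (fun w : E × E => ((0 : E), w.2))
    ((0 : E × E →L[ℝ] E).prod (ContinuousLinearMap.snd ℝ E E)) z :=
  (hasFDerivAt_const (0 : E) z).prodMk hasFDerivAt_snd

namespace HomogeneousPair

/-- Obtained by differentiating Euler's relation for G, which holds on an open set. -/
lemma fderiv_fderiv_snd (h : HomogeneousPair Ω G p) (hz : z ∈ Ω) (u : E × E) :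
    fderiv ℝ (fderiv ℝ G) z u (0, z.2) = (2 : ℝ) • fderiv ℝ G z u - fderiv ℝ G z (0, u.2) := by
  have h₁ : (fun w => fderiv ℝ G w (0, w.2)) =ᶠ[𝓝 z] fun w => (2 : ℝ) • G w := by
    filter_upwards [h.isOpen.mem_nhds hz] with w hw using h.euler w hw
  have h₂ := fderiv_fderiv_apply (h.smooth z hz) (hasFDerivAt_inr_snd (z := z)) u
  rw [h₁.fderiv_eq, fderiv_fun_const_smul (differentiableAt_of_smooth (h.smooth z hz))] at h₂
  exact eq_sub_of_add_eq h₂.symm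

lemma fderiv_fderiv_snd' (h : HomogeneousPair Ω G p) (hz : z ∈ Ω) (u : E × E) :
    fderiv ℝ (fderiv ℝ p) z u (0, z.2) = fderiv ℝ p z u - fderiv ℝ p z (0, u.2) := by
  have h₁ : (fun w => fderiv ℝ p w (0, w.2)) =ᶠ[𝓝 z] p := by
    filter_upwards [h.isOpen.mem_nhds hz] with w hw using h.euler' w hw
  have h₂ := fderiv_fderiv_apply (h.smooth' z hz) (hasFDerivAt_inr_snd (z := z)) u
  rw [h₁.fderiv_eq] at h₂
  exact eq_sub_of_add_eq h₂.symm

lemma conn_snd (h : HomogeneousPair Ω G p) (hz : z ∈ Ω) : conn G z z.2 = (2 : ℝ) • G z :=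
  h.euler z hz

/-- The vertical derivative of a 2-homogeneous function is 1-homogeneous. -/
lemma fderiv_fderiv_inr_snd (h : HomogeneousPair Ω G p) (hz : z ∈ Ω) (a : E) :
    fderiv ℝ (fderiv ℝ G) z (0, z.2) (0, a) = conn G z a := by
  rw [fderiv_fderiv_symm (h.smooth z hz), h.fderiv_fderiv_snd hz]
  simp only [conn, ContinuousLinearMap.comp_apply, ContinuousLinearMap.inr_apply]
  module

lemma fderiv_fderiv_inr_snd' (h : HomogeneousPair Ω G p) (hz : z ∈ Ω) (a : E) :
    fderiv ℝ (fderiv ℝ p) z (0, z.2) (0, a) = 0 := by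
  rw [fderiv_fderiv_symm (h.smooth' z hz), h.fderiv_fderiv_snd' hz]
  simp

/-- The derivative of `p` along the spray with coefficients `G`. -/
lemma fderiv_spray (z : E × E) : fderiv ℝ p z (z.2, -(2 : ℝ) • G z) =
    fderiv ℝ p z (z.2, 0) - 2 * fderiv ℝ p z (0, G z) := by
  have : ((z.2, -(2 : ℝ) • G z) : E × E) = (z.2, 0) - (2 : ℝ) • (0, G z) := by ext <;> simp
  rw [this, map_sub, map_smul, smul_eq_mul]

lemma spray_deformCoeff (z : E × E) : ((z.2, -(2 : ℝ) • deformCoeff G p z) : E × E) =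
    (z.2, -(2 : ℝ) • G z) - (2 * p z) • (0, z.2) := by
  ext
  · simp
  · simp only [deformCoeff, Prod.snd_sub, Prod.smul_snd]; module

/-- Coordinate form of h̄ = h − d_J P ⊗ C − P J. -/
lemma hor_deformCoeff (h : HomogeneousPair Ω G p) (hz : z ∈ Ω) (a : E) :
    ((a, -conn (deformCoeff G p) z a) : E × E) =
      (a, -conn G z a) - fderiv ℝ p z (0, a) • (0, z.2) - p z • (0, a) := by
  rw [conn_deformCoeff (h.smooth z hz) (h.smooth' z hz)]
  ext
  · simp
  · simp only [Prod.snd_sub, Prod.smul_snd]; module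

lemma curvature_deformCoeff (h : HomogeneousPair Ω G p) (hz : z ∈ Ω) (a b : E) :
    fderiv ℝ (fderiv ℝ (deformCoeff G p)) z (b, -conn (deformCoeff G p) z b) (0, a) =
      fderiv ℝ (fderiv ℝ G) z (b, -conn G z b) (0, a)
        - fderiv ℝ p z (0, b) • conn G z a - p z • fderiv ℝ (fderiv ℝ G) z (0, b) (0, a)
        + (fderiv ℝ (fderiv ℝ p) z (0, a) (b, -conn G z b)
            - p z * fderiv ℝ (fderiv ℝ p) z (0, b) (0, a)) • z.2
        - fderiv ℝ p z (0, a) • (conn G z b + fderiv ℝ p z (0, b) • z.2 + p z • b)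
        + (fderiv ℝ p z (b, -conn G z b) - 2 * p z * fderiv ℝ p z (0, b)) • a := by
  rw [fderiv_fderiv_deformCoeff h.isOpen hz h.smooth h.smooth', h.hor_deformCoeff hz,
    fderiv_fderiv_symm (h.smooth' z hz) (0, a) (b, -conn G z b)]
  simp only [map_sub, map_smul, sub_apply, smul_apply,
    h.fderiv_fderiv_inr_snd hz, h.fderiv_fderiv_inr_snd' hz, h.euler' z hz, Prod.snd_sub,
    Prod.smul_snd, smul_eq_mul]
  module

/-- A multiple of the identity plus a rank-one term along y: the shape that makes the trace
computable. -/
lemma jacobiCoeff_deformCoeff (h : HomogeneousPair Ω G p) (hz : z ∈ Ω) (a : E) :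
    jacobiCoeff (deformCoeff G p) z a = jacobiCoeff G z a +
      (p z ^ 2 - fderiv ℝ p z (z.2, -(2 : ℝ) • G z)) • a +
      (2 * fderiv ℝ p z (a, 0) - fderiv ℝ (fderiv ℝ p) z (z.2, -(2 : ℝ) • G z) (0, a)
        - fderiv ℝ p z (0, conn G z a) - p z * fderiv ℝ p z (0, a)) • z.2 := by
  have e : ∀ a b : E, ∀ c d : ℝ, fderiv ℝ p z (0, conn G z a + c • z.2 + d • b) =
      fderiv ℝ p z (0, conn G z a) + c * p z + d * fderiv ℝ p z (0, b) := fun a b c d => by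
    have : ((0, conn G z a + c • z.2 + d • b) : E × E) =
      (0, conn G z a) + c • (0, z.2) + d • (0, b) := by ext <;> simp
    rw [this]
    simp only [map_add, map_smul, h.euler' z hz, smul_eq_mul]
  simp only [jacobiCoeff, sub_apply, smul_apply, ContinuousLinearMap.comp_apply,
    ContinuousLinearMap.inl_apply, ContinuousLinearMap.inr_apply,
    fderiv_deformCoeff (h.smooth z hz) (h.smooth' z hz),
    fderiv_fderiv_deformCoeff h.isOpen hz h.smooth h.smooth', spray_deformCoeff,
    conn_deformCoeff (h.smooth z hz) (h.smooth' z hz), e]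
  simp only [map_sub, map_smul, map_add, sub_apply, smul_apply,
    h.fderiv_fderiv_inr_snd hz, h.fderiv_fderiv_inr_snd' hz, h.euler' z hz, Prod.snd_sub,
    Prod.smul_snd, smul_eq_mul, h.conn_snd hz]
  module

/-- The identity term contributes n (P² − S(P)); the rank-one term contributes its form evaluated at
y, which Euler's relations reduce to −(P² − S(P)). -/
lemma trace_jacobiCoeff [FiniteDimensional ℝ E] (h : HomogeneousPair Ω G p) (hz : z ∈ Ω) :
    LinearMap.trace ℝ E (jacobiCoeff (deformCoeff G p) z) =
      LinearMap.trace ℝ E (jacobiCoeff G z) + ((Module.finrank ℝ E : ℝ) - 1) *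
        (p z ^ 2 - fderiv ℝ p z (z.2, -(2 : ℝ) • G z)) := by
  let α : E →ₗ[ℝ] ℝ := ((2 : ℝ) • (fderiv ℝ p z).comp (ContinuousLinearMap.inl ℝ E E) -
    (fderiv ℝ (fderiv ℝ p) z (z.2, -(2 : ℝ) • G z)).comp (ContinuousLinearMap.inr ℝ E E)
    - ((fderiv ℝ p z).comp (ContinuousLinearMap.inr ℝ E E)).comp (conn G z)
    - p z • (fderiv ℝ p z).comp (ContinuousLinearMap.inr ℝ E E)).toLinearMap
  have hJ : (jacobiCoeff (deformCoeff G p) z).toLinearMap = (jacobiCoeff G z).toLinearMap +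
      (p z ^ 2 - fderiv ℝ p z (z.2, -(2 : ℝ) • G z)) • LinearMap.id + α.smulRight z.2 := by
    ext a
    exact h.jacobiCoeff_deformCoeff hz a
  have hα : α z.2 = 2 * fderiv ℝ p z (z.2, 0) -
      fderiv ℝ (fderiv ℝ p) z (z.2, -(2 : ℝ) • G z) (0, z.2)
        - fderiv ℝ p z (0, conn G z z.2) - p z * fderiv ℝ p z (0, z.2) := rfl
  have e : fderiv ℝ p z (0, (2 : ℝ) • G z) = 2 * fderiv ℝ p z (0, G z) := by
    rw [← smul_eq_mul, ← map_smul]; simp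
  have e' : fderiv ℝ p z (0, -(2 : ℝ) • G z) = -2 * fderiv ℝ p z (0, G z) := by
    rw [← smul_eq_mul, ← map_smul]; simp
  rw [hJ, map_add, map_add, LinearMap.map_smul, LinearMap.trace_id, LinearMap.trace_smulRight, hα,
    h.fderiv_fderiv_snd' hz, h.conn_snd hz, h.euler' z hz, fderiv_spray, e, e', smul_eq_mul]
  ring

end HomogeneousPair

end

/-! ### Change of W₁ and the Hamel condition in coordinates. -/

section
variable {E : Type*} [NormedAddCommGroup E] [NormedSpace ℝ E]
  {G : E × E → E} {p : E × E → ℝ} {z : E × E} {Ω : Set (E × E)}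

lemma contDiffAt_jacobiCoeff (hG : ContDiffAt ℝ ∞ G z) : ContDiffAt ℝ ∞ (jacobiCoeff G) z := by
  have hs : ContDiffAt ℝ ∞ (fun z : E × E => (z.2, -(2 : ℝ) • G z)) z :=
    contDiffAt_snd.prodMk (hG.const_smul _)
  have hN := contDiffAt_conn hG
  exact ((((contDiffAt_fderiv hG).clm_comp contDiffAt_const).const_smul (2 : ℝ)).sub
    (((contDiffAt_fderiv (contDiffAt_fderiv hG)).clm_apply hs).clm_comp contDiffAt_const)).sub
    (hN.clm_comp hN)

lemma differentiableAt_trace_jacobiCoeff [FiniteDimensional ℝ E] (hG : ContDiffAt ℝ ∞ G z) :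
    DifferentiableAt ℝ (fun w => LinearMap.trace ℝ E (jacobiCoeff G w)) z := by
  let t : (E →L[ℝ] E) →L[ℝ] ℝ := LinearMap.toContinuousLinearMap
    ((LinearMap.trace ℝ E).comp (ContinuousLinearMap.coeLM ℝ))
  exact t.differentiableAt.comp z (differentiableAt_of_smooth (contDiffAt_jacobiCoeff hG))

namespace HomogeneousPair

lemma hasFDerivAt_spray (h : HomogeneousPair Ω G p) (hz : z ∈ Ω) :
    HasFDerivAt (fun w : E × E => (w.2, -(2 : ℝ) • G w))
      ((ContinuousLinearMap.snd ℝ E E).prod (-(2 : ℝ) • fderiv ℝ G z)) z :=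
  hasFDerivAt_snd.prodMk ((differentiableAt_of_smooth (h.smooth z hz)).hasFDerivAt.const_smul _)

/-- Besides the second derivative of P, the vertical derivative of S(P) sees that of S itself, which
is `(a, -2 N a)`. -/
lemma fderiv_fderiv_spray (h : HomogeneousPair Ω G p) (hz : z ∈ Ω) (a : E) :
    fderiv ℝ (fun w => fderiv ℝ p w (w.2, -(2 : ℝ) • G w)) z (0, a) =
      fderiv ℝ (fderiv ℝ p) z (z.2, -(2 : ℝ) • G z) (0, a) + fderiv ℝ p z (a, 0)
        - 2 * fderiv ℝ p z (0, conn G z a) := by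
  rw [fderiv_fderiv_apply (h.smooth' z hz) (h.hasFDerivAt_spray hz),
    fderiv_fderiv_symm (h.smooth' z hz)]
  have : ((ContinuousLinearMap.snd ℝ E E).prod (-(2 : ℝ) • fderiv ℝ G z)) (0, a) =
      (a, 0) - (2 : ℝ) • (0, conn G z a) := by
    ext <;> simp [conn]
  rw [this, map_sub, map_smul, smul_eq_mul]
  ring

lemma fderiv_trace_jacobiCoeff [FiniteDimensional ℝ E] (h : HomogeneousPair Ω G p) (hz : z ∈ Ω)
    (a : E) :
    fderiv ℝ (fun w => LinearMap.trace ℝ E (jacobiCoeff (deformCoeff G p) w)) z (0, a) =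
      fderiv ℝ (fun w => LinearMap.trace ℝ E (jacobiCoeff G w)) z (0, a) +
        ((Module.finrank ℝ E : ℝ) - 1) * (2 * p z * fderiv ℝ p z (0, a)
          - fderiv ℝ (fderiv ℝ p) z (z.2, -(2 : ℝ) • G z) (0, a) - fderiv ℝ p z (a, 0)
          + 2 * fderiv ℝ p z (0, conn G z a)) := by
  have h₁ : (fun w => LinearMap.trace ℝ E (jacobiCoeff (deformCoeff G p) w)) =ᶠ[𝓝 z] fun w =>
      LinearMap.trace ℝ E (jacobiCoeff G w) + ((Module.finrank ℝ E : ℝ) - 1) *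
        (p w ^ 2 - fderiv ℝ p w (w.2, -(2 : ℝ) • G w)) := by
    filter_upwards [h.isOpen.mem_nhds hz] with w hw using h.trace_jacobiCoeff hw
  have hp := (differentiableAt_of_smooth (h.smooth' z hz)).hasFDerivAt
  have h₂ := (differentiableAt_of_smooth (contDiffAt_fderiv (h.smooth' z hz))).clm_apply
    (h.hasFDerivAt_spray hz).differentiableAt
  have h₃ : HasFDerivAt (fun w => LinearMap.trace ℝ E (jacobiCoeff G w) +
      ((Module.finrank ℝ E : ℝ) - 1) * (p w ^ 2 - fderiv ℝ p w (w.2, -(2 : ℝ) • G w))) _ z :=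
    (differentiableAt_trace_jacobiCoeff (h.smooth z hz)).hasFDerivAt.add
      (((hp.pow 2).sub h₂.hasFDerivAt).const_mul _)
  rw [h₁.fderiv_eq, h₃.fderiv]
  simp only [add_apply, smul_apply, sub_apply, h.fderiv_fderiv_spray hz, smul_eq_mul, nsmul_eq_mul, Nat.cast_ofNat,
    Nat.add_one_sub_one, pow_one]
  ring

/-- The projective change of the Weyl-type curvature, in coordinates. -/
lemma weyl_deformCoeff [FiniteDimensional ℝ E] (hn : 2 ≤ Module.finrank ℝ E)
    (h : HomogeneousPair Ω G p) (hz : z ∈ Ω) (a b : E) :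
    (fderiv ℝ (fderiv ℝ (deformCoeff G p)) z (b, -conn (deformCoeff G p) z b) (0, a) -
        fderiv ℝ (fderiv ℝ (deformCoeff G p)) z (a, -conn (deformCoeff G p) z a) (0, b)) -
      (1 / (2 * ((Module.finrank ℝ E : ℝ) - 1))) •
        (fderiv ℝ (fun w => LinearMap.trace ℝ E (jacobiCoeff (deformCoeff G p) w)) z (0, a) • b -
          fderiv ℝ (fun w => LinearMap.trace ℝ E (jacobiCoeff (deformCoeff G p) w)) z (0, b) • a) =
    (fderiv ℝ (fderiv ℝ G) z (b, -conn G z b) (0, a) -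
        fderiv ℝ (fderiv ℝ G) z (a, -conn G z a) (0, b)) -
      (1 / (2 * ((Module.finrank ℝ E : ℝ) - 1))) •
        (fderiv ℝ (fun w => LinearMap.trace ℝ E (jacobiCoeff G w)) z (0, a) • b -
          fderiv ℝ (fun w => LinearMap.trace ℝ E (jacobiCoeff G w)) z (0, b) • a) +
    (1 / 2 : ℝ) • (eulerLagrangeCoeff G p z a • b - eulerLagrangeCoeff G p z b • a) +
    dJdhCoeff G p z a b • z.2 := by
  -- The normalisation of W₁ is chosen for this cancellation; n ≥ 2 keeps the denominator nonzero.
  have hc : 1 / (2 * ((Module.finrank ℝ E : ℝ) - 1)) * ((Module.finrank ℝ E : ℝ) - 1) = 1 / 2 := by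
    have : (2 : ℝ) ≤ Module.finrank ℝ E := by exact_mod_cast hn
    have : (Module.finrank ℝ E : ℝ) - 1 ≠ 0 := by linarith
    field_simp
  have e : ∀ a : E, fderiv ℝ p z (a, -conn G z a) =
      fderiv ℝ p z (a, 0) - fderiv ℝ p z (0, conn G z a) := fun a => by
    rw [← map_sub]; simp
  rw [h.curvature_deformCoeff hz a b, h.curvature_deformCoeff hz b a,
    h.fderiv_trace_jacobiCoeff hz, h.fderiv_trace_jacobiCoeff hz, eulerLagrangeCoeff,
    eulerLagrangeCoeff, dJdhCoeff, e, e, fderiv_fderiv_symm (h.smooth z hz) (0, b) (0, a),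
    fderiv_fderiv_symm (h.smooth' z hz) (0, b) (0, a)]
  -- With the inverse as an atom the identity is linear modulo `hc`, whose multiplier is minus the
  -- contribution of the change of trace to the wedge product.
  generalize 1 / (2 * ((Module.finrank ℝ E : ℝ) - 1)) = c at hc ⊢
  linear_combination (norm := module)
    hc • ((2 * p z * fderiv ℝ p z (0, b)
          - fderiv ℝ (fderiv ℝ p) z (z.2, -(2 : ℝ) • G z) (0, b) - fderiv ℝ p z (b, 0)
          + 2 * fderiv ℝ p z (0, conn G z b)) • a - (2 * p z * fderiv ℝ p z (0, a)
          - fderiv ℝ (fderiv ℝ p) z (z.2, -(2 : ℝ) • G z) (0, a) - fderiv ℝ p z (a, 0)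
          + 2 * fderiv ℝ p z (0, conn G z a)) • b)

/-- Invariantly, δ_S P(S) = S(C(P)) − S(P) = 0. -/
lemma eulerLagrangeCoeff_snd (h : HomogeneousPair Ω G p) (hz : z ∈ Ω) :
    eulerLagrangeCoeff G p z z.2 = 0 := by
  have e' : fderiv ℝ p z (0, -(2 : ℝ) • G z) = -2 * fderiv ℝ p z (0, G z) := by
    rw [← smul_eq_mul, ← map_smul]; simp
  rw [eulerLagrangeCoeff, h.fderiv_fderiv_snd' hz, fderiv_spray, e']
  ring

/-- Since N y = 2G, the horizontal lift of y is S; the other term reduces to ∂P/∂x by Euler's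
relation. -/
lemma dJdhCoeff_snd (h : HomogeneousPair Ω G p) (hz : z ∈ Ω) (a : E) :
    dJdhCoeff G p z a z.2 = eulerLagrangeCoeff G p z a := by
  rw [dJdhCoeff, eulerLagrangeCoeff, h.conn_snd hz, ← neg_smul,
    fderiv_fderiv_symm (h.smooth' z hz) (0, z.2), h.fderiv_fderiv_snd' hz,
    fderiv_fderiv_symm (h.smooth' z hz) (0, a)]
  have : ((a, 0) : E × E) = (a, -conn G z a) - (0, -conn G z a) := by simp
  rw [this, map_sub]

/-- Taking `b = y` turns the hypothesis into (1/2 + 1) δ_S P(a) y = 0 with y ≠ 0. -/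
lemma eulerLagrangeCoeff_eq_zero (h : HomogeneousPair Ω G p) (hz : z ∈ Ω) (hz0 : z.2 ≠ 0)
    (h0 : ∀ a b, (1 / 2 : ℝ) • (eulerLagrangeCoeff G p z a • b - eulerLagrangeCoeff G p z b • a) +
      dJdhCoeff G p z a b • z.2 = 0) (a : E) : eulerLagrangeCoeff G p z a = 0 := by
  have := h0 a z.2
  rw [h.eulerLagrangeCoeff_snd hz, h.dJdhCoeff_snd hz, zero_smul, sub_zero, smul_smul,
    ← add_smul, smul_eq_zero, or_iff_left hz0] at this
  linarith

/-- The derivative of the Euler–Lagrange coefficients in vertical directions. -/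
lemma fderiv_eulerLagrangeCoeff (h : HomogeneousPair Ω G p) (hz : z ∈ Ω) (a b : E) :
    fderiv ℝ (fun w => eulerLagrangeCoeff G p w a) z (0, b) =
      fderiv ℝ (fderiv ℝ (fderiv ℝ p)) z (z.2, -(2 : ℝ) • G z) (0, b) (0, a)
      + fderiv ℝ (fderiv ℝ p) z (0, a) (b, 0) - 2 * fderiv ℝ (fderiv ℝ p) z (0, a) (0, conn G z b)
      - fderiv ℝ (fderiv ℝ p) z (0, b) (a, 0) := by
  have h2 := contDiffAt_fderiv (h.smooth' z hz)
  have h₁ : HasFDerivAt (fun w => eulerLagrangeCoeff G p w a) _ z :=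
    (((hasFDerivAt_fderiv h2).clm_apply (h.hasFDerivAt_spray hz)).clm_apply
      (hasFDerivAt_const (0, a) z)).sub
      ((hasFDerivAt_fderiv (h.smooth' z hz)).clm_apply (hasFDerivAt_const (a, 0) z))
  have hd : ((ContinuousLinearMap.snd ℝ E E).prod (-(2 : ℝ) • fderiv ℝ G z)) (0, b) =
      (b, 0) - (2 : ℝ) • (0, conn G z b) := by
    ext <;> simp [conn]
  rw [h₁.fderiv, ← fderiv_fderiv_symm h2 (0, b),
    fderiv_fderiv_symm (h.smooth' z hz) (0, a) (b, 0),
    fderiv_fderiv_symm (h.smooth' z hz) (0, a) (0, conn G z b)]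
  simp only [sub_apply, add_apply, ContinuousLinearMap.comp_apply, ContinuousLinearMap.flip_apply,
    zero_apply, map_zero, hd, map_sub, map_smul, smul_apply, smul_eq_mul]
  ring

/-- The antisymmetrised vertical derivative of δ_S P is, up to sign, 2 d_J d_h P: the third
derivatives of P are symmetric in the two vertical directions and drop out. -/
lemma dJdhCoeff_eq_zero (h : HomogeneousPair Ω G p) (hz : z ∈ Ω)
    (h0 : ∀ w ∈ Ω, ∀ a, eulerLagrangeCoeff G p w a = 0) (a b : E) : dJdhCoeff G p z a b = 0 := by
  have h₁ : ∀ a b, fderiv ℝ (fun w => eulerLagrangeCoeff G p w a) z (0, b) = 0 := fun a b => by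
    have : (fun w => eulerLagrangeCoeff G p w a) =ᶠ[𝓝 z] fun _ => 0 := by
      filter_upwards [h.isOpen.mem_nhds hz] with w hw using h0 w hw a
    rw [this.fderiv_eq]; simp
  have h₂ := h₁ a b
  have h₃ := h₁ b a
  have hsymm : fderiv ℝ (fderiv ℝ (fderiv ℝ p)) z (z.2, -(2 : ℝ) • G z) (0, b) (0, a) =
      fderiv ℝ (fderiv ℝ (fderiv ℝ p)) z (z.2, -(2 : ℝ) • G z) (0, a) (0, b) := by
    have hd : ∀ u v, fderiv ℝ (fun w => fderiv ℝ (fderiv ℝ p) w u v) z (z.2, -(2 : ℝ) • G z) =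
        fderiv ℝ (fderiv ℝ (fderiv ℝ p)) z (z.2, -(2 : ℝ) • G z) u v := fun u v => by
      rw [(((hasFDerivAt_fderiv (contDiffAt_fderiv (h.smooth' z hz))).clm_apply
        (hasFDerivAt_const u z)).clm_apply (hasFDerivAt_const v z)).fderiv]
      simp
    rw [← hd, ← hd]
    refine congrArg (fun L : E × E →L[ℝ] ℝ => L _) (EventuallyEq.fderiv_eq ?_)
    filter_upwards [h.isOpen.mem_nhds hz] with w hw
    exact fderiv_fderiv_symm (h.smooth' w hw) _ _
  rw [h.fderiv_eulerLagrangeCoeff hz] at h₂ h₃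
  have e : ∀ a b : E, fderiv ℝ (fderiv ℝ p) z (0, a) (b, -conn G z b) =
      fderiv ℝ (fderiv ℝ p) z (0, a) (b, 0) - fderiv ℝ (fderiv ℝ p) z (0, a) (0, conn G z b) :=
    fun a b => by rw [← map_sub]; simp
  rw [dJdhCoeff, e, e]
  linarith

end HomogeneousPair
end

/-! ### From coordinates back to the manifold. -/

section
variable {E : Type*} [NormedAddCommGroup E] [NormedSpace ℝ E]
  {M : Type*} [TopologicalSpace M] [ChartedSpace E M] [IsManifold 𝓘(ℝ, E) ∞ M]
  {p₀ : TM E M} {S : VF E M} {P : TM E M → ℝ} {z : E × E}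

/-- The image of the slit tangent bundle in the induced chart around `p₀`. -/
def slitTarget (p₀ : TM E M) : Set (E × E) := (chart p₀).target ∩ {z | z.2 ≠ 0}

lemma isOpen_slitTarget : IsOpen (slitTarget p₀) :=
  isOpen_chart_target.inter (isOpen_ne.preimage continuous_snd)

lemma mem_slit_of_mem_slitTarget (hz : z ∈ slitTarget p₀) : (chart p₀).symm z ∈ slit E M :=
  (mem_slit_iff hz.1).2 hz.2

lemma exists_mem_slitTarget (hp : p₀ ∈ slit E M) :
    ∃ z ∈ slitTarget p₀, (chart p₀).symm z = p₀ := by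
  have hs : p₀ ∈ (chart p₀).source := mem_extChartAt_source p₀
  have ht := (chart p₀).map_source hs
  refine ⟨chart p₀ p₀, ⟨ht, (mem_slit_iff ht).1 ?_⟩, (chart p₀).left_inv hs⟩
  rwa [(chart p₀).left_inv hs]

/-- The coefficients `G^i` of a spray in the induced chart around `p₀`. -/
def sprayCoeff (p₀ : TM E M) (S : VF E M) (z : E × E) : E := -(1 / 2 : ℝ) • (coord p₀ S z).2

/-- JS = C forces the horizontal component of S to be y; the vertical component then defines G. -/
lemma localSpray [CompleteSpace E] (hS : IsSpray S) :
    LocalSpray p₀ S (slitTarget p₀) (sprayCoeff p₀ S) := by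
  refine ⟨isOpen_slitTarget, Set.inter_subset_left, fun z hz => ?_, fun z hz => ?_⟩
  · exact (contDiffAt_coord hz.1 (hS.smooth _ (mem_slit_of_mem_slitTarget hz))).snd.const_smul _
  · have h := (eq_iff_coord_eq (X := J S) (Y := liouville) hz.1).1
      (hS.semispray _ (mem_slit_of_mem_slitTarget hz))
    rw [coord_J hz.1, coord_liouville hz.1] at h
    ext
    · exact congrArg Prod.snd h
    · simp only [sprayCoeff]; module

/-- The vertical component of [C, S] = S is −2 ∂G/∂y · y + 2G = −2G, Euler's relation of degree 2.
-/
lemma homogeneousPair [CompleteSpace E] (hS : IsSpray S) (hP : IsHomogeneous P) :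
    HomogeneousPair (slitTarget p₀) (sprayCoeff p₀ S) (coordFun p₀ P) := by
  have h := localSpray (p₀ := p₀) hS
  refine ⟨isOpen_slitTarget, h.smooth, fun z hz => ?_, fun z hz => ?_, fun z hz => ?_⟩
  · exact contDiffAt_coordFun hz.1 (hP.smooth _ (mem_slit_of_mem_slitTarget hz))
  · have hC : coord p₀ liouville =ᶠ[𝓝 z] fun w => (0, w.2) := by
      filter_upwards [h.isOpen.mem_nhds hz] with w hw using coord_liouville hw.1
    have hC' := (hasFDerivAt_inr_snd (z := z)).congr_of_eventuallyEq hC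
    have h' := (eq_iff_coord_eq (X := bracket liouville S) (Y := S) hz.1).1
      (hS.homogeneous _ (mem_slit_of_mem_slitTarget hz))
    rw [coord_bracket hz.1 hC'.differentiableAt
      (differentiableAt_of_smooth (h.smoothCoordOn z hz)), hC'.fderiv, coord_liouville hz.1,
      h.fderiv_coord hz, h.eq z hz] at h'
    have h'' : -(2 : ℝ) • fderiv ℝ (sprayCoeff p₀ S) z (0, z.2) -
        -(2 : ℝ) • sprayCoeff p₀ S z = -(2 : ℝ) • sprayCoeff p₀ S z := congrArg Prod.snd h'
    linear_combination (norm := module) (-(1 / 2) : ℝ) • h''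
  · have h' := hP.euler _ (mem_slit_of_mem_slitTarget hz)
    rwa [deriv_eq hz.1, coord_liouville hz.1] at h'

lemma LocalSpray.deform {Ω : Set (E × E)} {G : E × E → E} (h : LocalSpray p₀ S Ω G)
    (hP : ∀ z ∈ Ω, ContDiffAt ℝ ∞ (coordFun p₀ P) z) :
    LocalSpray p₀ (deform S P) Ω (deformCoeff G (coordFun p₀ P)) := by
  refine ⟨h.isOpen, h.subset, fun z hz => contDiffAt_deformCoeff (h.smooth z hz) (hP z hz),
    fun z hz => ?_⟩
  rw [coord_deform, h.eq z hz, coord_liouville (h.subset hz)]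
  ext
  · simp
  · simp only [deformCoeff, Prod.snd_sub, Prod.smul_snd]; module

variable [FiniteDimensional ℝ E]

/-- The projective change of the Weyl-type curvature, read in an induced chart. -/
lemma coord_weyl_deform (hn : 2 ≤ Module.finrank ℝ E) (hS : IsSpray S) (hP : IsHomogeneous P)
    {X Y : VF E M} (hz : z ∈ slitTarget p₀) (hX : SmoothNear ((chart p₀).symm z) X)
    (hY : SmoothNear ((chart p₀).symm z) Y) :
    coord p₀ (weyl (deform S P) X Y) z = coord p₀ (weyl S X Y) z +
      (0, (1 / 2 : ℝ) • (eulerLagrangeCoeff (sprayCoeff p₀ S) (coordFun p₀ P) z (coord p₀ X z).1 •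
          (coord p₀ Y z).1 - eulerLagrangeCoeff (sprayCoeff p₀ S) (coordFun p₀ P) z
            (coord p₀ Y z).1 • (coord p₀ X z).1) +
        dJdhCoeff (sprayCoeff p₀ S) (coordFun p₀ P) z (coord p₀ X z).1 (coord p₀ Y z).1 •
          z.2) := by
  have : CompleteSpace E := FiniteDimensional.complete ℝ E
  have h := localSpray (p₀ := p₀) hS
  have hh := homogeneousPair (p₀ := p₀) hS hP
  -- The test fields are smooth only near the point, so the coordinate domain is shrunk once for
  -- each.
  obtain ⟨Ω₁, hΩ₁, ho₁, hz₁, hX⟩ := exists_smoothCoordOn h.isOpen h.subset hz hX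
  obtain ⟨Ω₂, hΩ₂, ho₂, hz₂, hY⟩ := exists_smoothCoordOn ho₁ (hΩ₁.trans h.subset) hz₁ hY
  have h₂ := h.mono ho₂ (hΩ₂.trans hΩ₁)
  have hX₂ : SmoothCoordOn p₀ Ω₂ X := fun w hw => hX w (hΩ₂ hw)
  have h₂' := h₂.deform fun w hw => hh.smooth' w (hΩ₁ (hΩ₂ hw))
  rw [h₂'.coord_weyl hX₂ hY hz₂, h₂.coord_weyl hX₂ hY hz₂, h₂'.coord_curvature hX₂ hY hz₂,
    h₂.coord_curvature hX₂ hY hz₂, hh.weyl_deformCoeff hn hz]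
  ext
  · simp
  · simp only [Prod.snd_add]; module

lemma eulerLagrange_eq (hS : IsSpray S) (hP : IsHomogeneous P)
    {X : VF E M} (hz : z ∈ slitTarget p₀) (hX : SmoothNear ((chart p₀).symm z) X) :
    eulerLagrange S P X ((chart p₀).symm z) =
      eulerLagrangeCoeff (sprayCoeff p₀ S) (coordFun p₀ P) z (coord p₀ X z).1 := by
  have : CompleteSpace E := FiniteDimensional.complete ℝ E
  have h := localSpray (p₀ := p₀) hS
  obtain ⟨Ω₁, hΩ₁, ho₁, hz₁, hX⟩ := exists_smoothCoordOn h.isOpen h.subset hz hX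
  exact (h.mono ho₁ hΩ₁).eulerLagrange_eq hX
    (fun w hw => (homogeneousPair hS hP).smooth' w (hΩ₁ hw)) hz₁

lemma dEndForm_eq (hS : IsSpray S) (hP : IsHomogeneous P)
    {X Y : VF E M} (hz : z ∈ slitTarget p₀) (hX : SmoothNear ((chart p₀).symm z) X)
    (hY : SmoothNear ((chart p₀).symm z) Y) :
    dEndForm J (dEnd (hor S) P) X Y ((chart p₀).symm z) =
      dJdhCoeff (sprayCoeff p₀ S) (coordFun p₀ P) z (coord p₀ X z).1 (coord p₀ Y z).1 := by
  have : CompleteSpace E := FiniteDimensional.complete ℝ E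
  have h := localSpray (p₀ := p₀) hS
  obtain ⟨Ω₁, hΩ₁, ho₁, hz₁, hX⟩ := exists_smoothCoordOn h.isOpen h.subset hz hX
  obtain ⟨Ω₂, hΩ₂, ho₂, hz₂, hY⟩ := exists_smoothCoordOn ho₁ (hΩ₁.trans h.subset) hz₁ hY
  exact (h.mono ho₂ (hΩ₂.trans hΩ₁)).dEndForm_eq (fun w hw => hX w (hΩ₂ hw)) hY
    (fun w hw => (homogeneousPair hS hP).smooth' w (hΩ₁ (hΩ₂ hw))) hz₂

/-- The vector field near a point of an induced chart with constant horizontal coordinates. -/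
lemma exists_coord_eq (hz : z ∈ slitTarget p₀) (a : E) :
    ∃ X : VF E M, SmoothNear ((chart p₀).symm z) X ∧ (coord p₀ X z).1 = a := by
  have : CompleteSpace E := FiniteDimensional.complete ℝ E
  refine ⟨ofCoord p₀ fun _ => (a, 0), smoothNear_ofCoord ((chart p₀).map_target hz.1)
    contDiff_const, ?_⟩
  rw [coord_ofCoord hz.1]

lemma eulerLagrangeCoeff_eq_zero_of_isHamel (hS : IsSpray S) (hP : IsHamel S P)
    (hz : z ∈ slitTarget p₀) (a : E) :
    eulerLagrangeCoeff (sprayCoeff p₀ S) (coordFun p₀ P) z a = 0 := by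
  obtain ⟨X, hX, rfl⟩ := exists_coord_eq hz a
  rw [← eulerLagrange_eq hS hP.1 hz hX]
  exact hP.2 _ (mem_slit_of_mem_slitTarget hz) X hX

end

end SprayGeometry

end

/-! ### The theorem. -/

theorem lemma3p3 {E : Type*} [NormedAddCommGroup E] [NormedSpace ℝ E] [FiniteDimensional ℝ E]
    {M : Type*} [TopologicalSpace M] [T2Space M] [ChartedSpace E M] [IsManifold 𝓘(ℝ, E) ∞ M]
    (hn : 2 ≤ Module.finrank ℝ E)
    (S : SprayGeometry.VF E M) (hS : SprayGeometry.IsSpray S)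
    (P : SprayGeometry.TM E M → ℝ) (hP : SprayGeometry.IsHomogeneous P) :
    (∀ p ∈ SprayGeometry.slit E M, ∀ X Y : SprayGeometry.VF E M,
      SprayGeometry.SmoothNear p X → SprayGeometry.SmoothNear p Y →
      SprayGeometry.weyl (SprayGeometry.deform S P) X Y p =
        SprayGeometry.weyl S X Y p
        + (1 / 2 : ℝ) •
            SprayGeometry.wedge (SprayGeometry.eulerLagrange S P) SprayGeometry.J X Y p
        + SprayGeometry.tensor
            (SprayGeometry.dEndForm SprayGeometry.J
              (SprayGeometry.dEnd (SprayGeometry.hor S) P))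
            SprayGeometry.liouville X Y p) ∧
    ((∀ p ∈ SprayGeometry.slit E M, ∀ X Y : SprayGeometry.VF E M,
      SprayGeometry.SmoothNear p X → SprayGeometry.SmoothNear p Y →
      SprayGeometry.weyl (SprayGeometry.deform S P) X Y p = SprayGeometry.weyl S X Y p) ↔
      SprayGeometry.IsHamel S P) := by
  open SprayGeometry in
  refine ⟨fun p hp X Y hX hY => ?_, fun hW => ⟨hP, fun p hp X hX => ?_⟩,
    fun hH p hp X Y hX hY => ?_⟩
  · obtain ⟨z, hz, hzp⟩ := exists_mem_slitTarget hp
    rw [← hzp] at hX hY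
    have key := (eq_iff_coord_eq (p₀ := p) (X := weyl (deform S P) X Y)
      (Y := weyl S X Y + (1 / 2 : ℝ) • wedge (eulerLagrange S P) J X Y
        + tensor (dEndForm J (dEnd (hor S) P)) liouville X Y) hz.1).2 (by
      rw [coord_weyl_deform hn hS hP hz hX hY, coord_add, coord_add, coord_smul, coord_wedge,
        coord_tensor, coord_J hz.1, coord_J hz.1, coord_liouville hz.1,
        eulerLagrange_eq hS hP hz hX, eulerLagrange_eq hS hP hz hY, dEndForm_eq hS hP hz hX hY]
      ext
      · simp
      · simp only [Prod.snd_add, Prod.smul_snd, Prod.snd_sub]; module)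
    rw [hzp] at key
    exact key
  · obtain ⟨z, hz, hzp⟩ := exists_mem_slitTarget hp
    rw [← hzp] at hX
    -- Local fields with arbitrary horizontal components at the point turn equality of the tensors
    -- into an identity for all `a` and `b`.
    have := (homogeneousPair hS hP).eulerLagrangeCoeff_eq_zero hz hz.2 (fun a b => by
      obtain ⟨A, hA, rfl⟩ := exists_coord_eq hz a
      obtain ⟨B, hB, rfl⟩ := exists_coord_eq hz b
      have h₁ := hW _ (mem_slit_of_mem_slitTarget hz) A B hA hB
      rw [eq_iff_coord_eq hz.1, coord_weyl_deform hn hS hP hz hA hB, add_eq_left] at h₁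
      exact congrArg Prod.snd h₁) (coord p X z).1
    rw [← hzp, ← this]
    rw [eulerLagrange_eq hS hP hz hX]
  · obtain ⟨z, hz, hzp⟩ := exists_mem_slitTarget hp
    rw [← hzp] at hX hY ⊢
    -- Vanishing is needed on the whole open set, since it is differentiated to get d_J d_h P = 0.
    have h0 : ∀ w ∈ slitTarget p, ∀ a,
        eulerLagrangeCoeff (sprayCoeff p S) (coordFun p P) w a = 0 :=
      fun w hw => eulerLagrangeCoeff_eq_zero_of_isHamel hS hH hw
    rw [eq_iff_coord_eq hz.1, coord_weyl_deform hn hS hP hz hX hY, h0 z hz, h0 z hz,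
      (homogeneousPair hS hP).dJdhCoeff_eq_zero hz h0]
    ext <;> simp
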